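/- Notation. For a positive integer $n$ let $\zeta_n=e^{2\pi i/n}\in\mathbb C$ and let $O_n$ be the ring of integers of $\mathbb{Q}(\zeta_n)$. For a prime ideal $P$ of $O_k$ over a prime $p\nmid k$, the Teichmüller character $\chi_P$ of $O_k/P$ is given by $\chi_P(0)=0$ and, for $\alpha\notin P$, by letting $\chi_P(\alpha+P)$ be the unique power of $\zeta_k$ congruent to $\alpha^{(|O_k/P|-1)/k}$ modulo $P$. The canonical additive character of $\mathbb F_{p^f}$ is $\psi(x)=\zeta_p^{\mathrm{Tr}(x)}$, with $\mathrm{Tr}$ the trace to $\mathbb F_p$. For a multiplicative character $\chi$ of $\mathbb F_{p^f}$ put $G_f(\chi)=\sum_{x\ne 0}\chi(x)\psi(x)$, and for nontrivial $\chi'$ on $\mathbb F_{p^{f'}}$ and $\chi$ on $\mathbb F_{p^f}$ put $\vartheta_p(\chi',\chi)=G_{f'}(\chi')/\bigl(p^{(f'-f)/2}G_f(\chi)\bigr)$. For a primitive root $\gamma$ of $\mathbb F_q$ let $C_i^{(k,q)}=\gamma^i\langle\gamma^k\rangle$, and for $D\subseteq\mathbb F_q$ let $\psi(\gamma^aD)=\sum_{x\in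 D}\psi(\gamma^a x)$. The same conventions are used over $\mathbb F_{q'}$, with the primitive root $\omega$ and the canonical additive character $\psi'$. Setting. Let $\ell\ge 1$, $t\ge 0$, let $p_1,\dots,p_\ell$ be distinct odd primes, $e_1,\dots,e_\ell\ge 1$, and put $h=2^tp_1\cdots p_\ell$, $k=2^tp_1^{e_1}\cdots p_\ell^{e_\ell}$, $k'=kp_1$. Let $p$ be a prime not dividing $h$ such that for every divisor $d=2^sp_{i_1}\cdots p_{i_m}$ of $h$ (with $i_1,\dots,i_m$ distinct) and all $x_1,\dots,x_m\ge 1$, the index of $\langle p\rangle$ in $(\mathbb Z/d'\mathbb Z)^\ast$, where $d'=2^sp_{i_1}^{x_1}\cdots p_{i_m}^{x_m}$, equals the index of $\langle p\rangle$ in $(\mathbb Z/d\mathbb Z)^\ast$. Let $e$ be the index of $\langle p\rangle$ in $(\mathbb Z/h\mathbb Z)^\ast$ and let $f=\phi(k)/e$, $f'=\phi(k')/e$, $q=p^f$, $q'=p^{f'}$. Let $P\subset O_k$ and $P'\subset O_{k'}$ be prime ideals over $p$ with $P'\cap O_k=P$, and identify $O_k/P$ with $\mathbb F_q$ and $O_{k'}/P'$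 with $\mathbb F_{q'}$, so that $\chi_P$ and $\chi_{P'}$ become characters of $\mathbb F_q$ and $\mathbb F_{q'}$. Let $\gamma$ and $\omega$ be primitive roots of $\mathbb F_q$ and $\mathbb F_{q'}$, chosen compatibly, that is, with $\chi_{P'}(\omega)^{p_1}=\chi_P(\gamma)$. Theorem. Let $J$ be the set of positive divisors of $k$ that are not divisible by $p_1^{e_1}$, let $J=J_1\sqcup J_2$ be a partition (either part may be empty), let $\epsilon\in\{1,-1\}$, and let $I\subseteq\{0,1,\dots,k-1\}$. Suppose that (i) $\sum_{i\in I}\zeta_k^{ij}=0$ for all $j\in J_1$; (ii) $\vartheta_p(\chi_{P'}^j,\chi_P^j)=\epsilon$ for all $j\in J_2$; (iii) if $\ell\ge 2$ or $t\ge 1$, then $G_{f'}(\chi_{P'}^{-p_1^{e_1+1}v})=\epsilon\, p^{\frac{\phi(k')-\phi(k)}{2e}}\,G_f(\chi_P^{-p_1^{e_1}v})$ for all $1\le v\le k/p_1^{e_1}-1$. Let $$D=\bigcup_{i\in I}C_i^{(k,q)}\subseteq\mathbb F_q,\qquad D'=\bigcup_{i\in I}\bigcup_{j=0}^{p_1-1}C_{ip_1+jk/p_1^{e_1}}^{(kp_1,q')}\subseteq\mathbb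 F_{q'}.$$ If the set $\{\psi(\gamma^aD): 0\le a\le q-2\}$ has exactly two elements, then the set $\{\psi'(\omega^aD'): 0\le a\le q'-2\}$ has exactly two elements, and these are the numbers $$\epsilon\, p^{\frac{\phi(k)(p_1-1)}{2e}}\,s+\frac{|I|\bigl(\epsilon\, p^{\frac{\phi(k)(p_1-1)}{2e}}-1\bigr)}{k},\qquad s\in\{\psi(\gamma^aD): 0\le a\le q-2\}.$$ -/

import Mathlib

open scoped NumberField

noncomputable section

/-- The complex root of unity `ζ_n = exp (2πi / n)`. -/
def zetaC (n : ℕ) : ℂ := Complex.exp (2 * Real.pi * Complex.I / n)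

/-- The cyclotomic field `ℚ(ζ_n)`, as a subfield of `ℂ`. -/
abbrev cycField (n : ℕ) : IntermediateField ℚ ℂ := IntermediateField.adjoin ℚ {zetaC n}

/-- The index `[(ℤ/dℤ)ˣ : ⟨p⟩]` of the subgroup generated by `p` (for `p` coprime to `d`). -/
def powIndex (p d : ℕ) : ℕ :=
  (Subgroup.closure {u : (ZMod d)ˣ | (u : ZMod d) = (p : ZMod d)}).index

/-- `w` is a power of `ζ_k` with `w ≡ α ^ ((q - 1) / k)` modulo `P`, where `q = #(O_K / P)`. -/
def IsTeichmullerValue (k : ℕ) (P : Ideal (𝓞 (cycField k))) (α : 𝓞 (cycField k) ⧸ P)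
    (w : ℂ) : Prop :=
  (∃ n : ℕ, w = zetaC k ^ n) ∧
    ∃ z : 𝓞 (cycField k), ((z : cycField k) : ℂ) = w ∧
      Ideal.Quotient.mk P z = α ^ ((Nat.card (𝓞 (cycField k) ⧸ P) - 1) / k)

/-- A nonzero residue class modulo a prime ideal over a prime number not dividing `k` has exactly
one Teichmüller value. -/
theorem existsUnique_isTeichmullerValue (k p : ℕ) [NeZero k] [Fact p.Prime] (hpk : p.Coprime k)
    (P : Ideal (𝓞 (cycField k))) (hP : P.IsPrime) (hpP : (p : 𝓞 (cycField k)) ∈ P)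
    (α : 𝓞 (cycField k) ⧸ P) (hα : α ≠ 0) : ∃! w : ℂ, IsTeichmullerValue k P α w := by
  have hζ : IsPrimitiveRoot (zetaC k) k := Complex.isPrimitiveRoot_exp k (NeZero.ne k)
  have hfin : FiniteDimensional ℚ (cycField k) :=
    IntermediateField.adjoin.finiteDimensional
      ((hζ.isIntegral (NeZero.pos k)).tower_top (A := ℚ))
  have : NumberField (cycField k) := { to_charZero := inferInstance, to_finiteDimensional := hfin }
  let ζK : cycField k := ⟨zetaC k, IntermediateField.mem_adjoin_simple_self ℚ (zetaC k)⟩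
  have hζK : IsPrimitiveRoot ζK k :=
    IsPrimitiveRoot.of_map_of_injective (f := (cycField k).val) hζ (cycField k).val.injective
  let z : 𝓞 (cycField k) := ⟨ζK, hζK.isIntegral (NeZero.pos k)⟩
  have hz : IsPrimitiveRoot z k :=
    IsPrimitiveRoot.of_map_of_injective (f := algebraMap (𝓞 (cycField k)) (cycField k)) hζK
      NumberField.RingOfIntegers.coe_injective
  have hzn : ∀ n : ℕ, (((z ^ n : 𝓞 (cycField k)) : cycField k) : ℂ) = zetaC k ^ n := by
    intro n
    rfl
  have hpne : (p : 𝓞 (cycField k)) ≠ 0 := Nat.cast_ne_zero.mpr (Fact.out : p.Prime).ne_zero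
  have hPbot : P ≠ ⊥ := by
    rintro rfl
    exact hpne (by simpa using hpP)
  have hmax : P.IsMaximal := Ring.DimensionLEOne.maximalOfPrime hPbot hP
  let _ := Ideal.Quotient.field P
  have : Finite (𝓞 (cycField k) ⧸ P) := inferInstance
  have : Fintype (𝓞 (cycField k) ⧸ P) := Fintype.ofFinite _
  have hp0 : (p : 𝓞 (cycField k) ⧸ P) = 0 := by
    have := Ideal.Quotient.eq_zero_iff_mem.mpr hpP
    simpa using this
  have : CharP (𝓞 (cycField k) ⧸ P) p := by
    have h1 := ringChar.dvd hp0
    rcases (Nat.dvd_prime (Fact.out : p.Prime)).mp h1 with h2 | h2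
    · exact absurd h2 (CharP.ringChar_ne_one)
    · exact ringChar.of_eq h2
  obtain ⟨n, hprime, hcard⟩ := FiniteField.card (𝓞 (cycField k) ⧸ P) p
  have habs : Ideal.absNorm P = p ^ (n : ℕ) := by
    rw [Ideal.absNorm_apply, Submodule.cardQuot_apply, Nat.card_eq_fintype_card]
    exact hcard
  have hbar : IsPrimitiveRoot (Ideal.Quotient.mk P z) k :=
    hz.idealQuotient_mk (by simpa using hmax.ne_top)
      (by rw [habs]; exact Nat.Coprime.pow_left _ hpk)
  have hone : α ^ (Nat.card (𝓞 (cycField k) ⧸ P) - 1) = 1 := by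
    rw [Nat.card_eq_fintype_card]
    exact FiniteField.pow_card_sub_one_eq_one α hα
  have hdvd : k ∣ Nat.card (𝓞 (cycField k) ⧸ P) - 1 := by
    rw [Nat.card_eq_fintype_card]
    exact hbar.dvd_of_pow_eq_one _
      (FiniteField.pow_card_sub_one_eq_one _ (hbar.ne_zero (NeZero.ne k)))
  obtain ⟨i, -, hi⟩ := hbar.eq_pow_of_pow_eq_one
    (ξ := α ^ ((Nat.card (𝓞 (cycField k) ⧸ P) - 1) / k))
    (by rw [← pow_mul, Nat.div_mul_cancel hdvd, hone])
  refine ⟨zetaC k ^ i, ⟨⟨i, rfl⟩, z ^ i, hzn i, by rw [map_pow, hi]⟩, ?_⟩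
  rintro w ⟨⟨j, rfl⟩, y, hy, hyα⟩
  have hyz : y = z ^ j := by
    apply NumberField.RingOfIntegers.coe_injective
    apply Subtype.coe_injective
    exact hy.trans (hzn j).symm
  rw [hyz, map_pow, ← hi] at hyα
  have hmod : j ≡ i [MOD k] := by
    have h1 := (hbar.isOfFinOrder (NeZero.ne k)).pow_eq_pow_iff_modEq.mp hyα
    rwa [← hbar.eq_orderOf] at h1
  exact (hζ.isOfFinOrder (NeZero.ne k)).pow_eq_pow_iff_modEq.mpr
    (hζ.eq_orderOf ▸ hmod)

open Classical in
/-- The Teichmüller character `χ_P` on the residue ring `O_K / P`, `K = ℚ(ζ_k)`: it is `0` at `0`,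
and at `α ≠ 0` it is the power of `ζ_k` congruent to `α ^ ((q - 1) / k)` modulo `P`; this power is
unique when `P` is a prime ideal over a prime number not dividing `k`
(see `existsUnique_isTeichmullerValue`). -/
def teichmuller (k : ℕ) (P : Ideal (𝓞 (cycField k))) (α : 𝓞 (cycField k) ⧸ P) : ℂ :=
  if α = 0 then 0 else Classical.epsilon (IsTeichmullerValue k P α)

/-- The Teichmüller character of `P`, read as a character of a finite field `F` through an
identification of `O_K / P` with `F`. -/
def teichmullerChar (k : ℕ) (P : Ideal (𝓞 (cycField k))) {F : Type*} [Field F]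
    (ι : (𝓞 (cycField k) ⧸ P) ≃+* F) : F → ℂ :=
  fun x => teichmuller k P (ι.symm x)

/-- The canonical additive character `ψ(x) = ζ_p ^ Tr(x)` of a finite field of characteristic `p`,
with `Tr` the trace to the prime field. -/
def canonicalChar (p : ℕ) [Fact p.Prime] {F : Type*} [Field F] [Algebra (ZMod p) F] (x : F) : ℂ :=
  ZMod.stdAddChar (Algebra.trace (ZMod p) F x)

open Classical in
/-- The Gauss sum `G(χ) = ∑_{x ≠ 0} χ(x) ψ(x)`. -/
def gaussS (p : ℕ) [Fact p.Prime] {F : Type*} [Field F] [Fintype F] [Algebra (ZMod p) F]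
    (χ : F → ℂ) : ℂ :=
  ∑ x : F with x ≠ 0, χ x * canonicalChar p x

/-- The relative Gauss sum `ϑ_p(χ', χ) = G_{f'}(χ') / (p ^ ((f' - f) / 2) G_f(χ))`, for `χ'` on a
field of `p ^ f'` elements and `χ` on a field of `p ^ f` elements. -/
def relGaussSum (p f' f : ℕ) [Fact p.Prime] {F' F : Type*} [Field F'] [Fintype F']
    [Algebra (ZMod p) F'] [Field F] [Fintype F] [Algebra (ZMod p) F]
    (χ' : F' → ℂ) (χ : F → ℂ) : ℂ :=
  gaussS p χ' / ((((p : ℝ) ^ (((f' : ℝ) - (f : ℝ)) / 2) : ℝ) : ℂ) * gaussS p χ)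

/-- The cyclotomic class `C_i = γ ^ i ⟨γ ^ k⟩` of order `k` with respect to `γ`. -/
def cycClass (k : ℕ) {F : Type*} [Field F] (γ : Fˣ) (i : ℕ) : Set F :=
  {x | ∃ y ∈ Subgroup.zpowers (γ ^ k), x = ((γ ^ i * y : Fˣ) : F)}

open Classical in
/-- `ψ(bD) = ∑_{x ∈ D} ψ(b x)`, with `ψ` the canonical additive character. -/
def psiSum (p : ℕ) [Fact p.Prime] {F : Type*} [Field F] [Fintype F] [Algebra (ZMod p) F]
    (b : F) (D : Set F) : ℂ :=
  ∑ x : F with x ∈ D, canonicalChar p (b * x)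

/-- The set `{ψ(γ ^ a D) | a = 0, 1, …, q - 2}`, with `q = #F`. -/
def psiValues (p : ℕ) [Fact p.Prime] {F : Type*} [Field F] [Fintype F] [Algebra (ZMod p) F]
    (γ : Fˣ) (D : Set F) : Set ℂ :=
  {z | ∃ a : ℕ, a ≤ Fintype.card F - 2 ∧ z = psiSum p ((γ : F) ^ a) D}

end

open scoped NumberField

noncomputable section

/-! Write r = p_1, m = e_1, N = k / r^m, g = χ_P(γ), w = χ_{P'}(ω), so that w^r = g. Let G(z) and
G'(z) be the Gauss sums over 𝔽_q and 𝔽_{q'} of the characters with value z at γ and at ω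
(`gammaSum`), and let c = ε p^(φ(k)(r-1)/(2e)). The theorem comes from a pointwise identity
(`psiSum_lift`): if a + uN = rb with 0 ≤ u < r, then ψ'(ω^a D') = c ψ(γ^b D) + |I|(c - 1)/k. As r is
prime to N, every a admits such a u, and every b occurs (take a = rb, u = 0). So the two value sets
correspond under an affine map, injective because c ≠ 0.

For the identity, expand both sides in Gauss sums. The coefficient of G'(w^(-j)) for D' contains the
product of ∑_{i ∈ I} g^(ij) and ∑_{v < r} w^(jvN). If G'(w^(-j)) may be replaced by c G(g^(-j)), the
second factor folds the sum modulo kr into one modulo k (`sum_range_mul_fourier`). The term j = 0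
produces the constant. If r^m does not divide j, then either (i) kills the first factor or (ii)
allows the replacement; both are carried from gcd(j, kr) to j or -j by Galois conjugation. If r^m
divides j but r^(m+1) does not, the second factor vanishes.

There remains j = r^(m+1) v, where (iii) provides G(g^(-r^m v)) in place of the required
G(g^(-r^(m+1) v)). So G(z^r) = G(z) is needed for z^N = 1. Since f' = rf with r odd, Davenport–Hasse
gives G'(z) = G(z)^r, and (iii) becomes G(z)^(r-1) = c for all z ≠ 1 with z^N = 1. Hence G(z) is a
root of unity times a reference number R independent of z, and an automorphism of ℂ acting as x ↦
x^r on N-th roots of unity can be chosen to fix both factors and ζ_p (`gammaSum_pow_eq`). It maps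
G(z) to G(z^r), so the two agree. -/

/-! ### Automorphisms of ℂ with prescribed action on roots of unity. -/

theorem exists_ringEquiv_extending {K : Type*} [Field K] [Algebra K ℂ] (σ : K ≃+* K) :
    ∃ τ : ℂ ≃+* ℂ, ∀ x : K, τ (algebraMap K ℂ x) = algebraMap K ℂ (σ x) := by
  -- ℂ is an algebraic closure of the polynomial ring K[s]; σ acts on the coefficients there, and
  -- the resulting automorphism extends to ℂ.
  obtain ⟨s, hs⟩ := exists_isTranscendenceBasis K ℂ
  have := IsAlgClosed.isAlgClosure_of_transcendence_basis _ hs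
  let E : Algebra.adjoin K (Set.range ((↑) : s → ℂ)) ≃+*
      Algebra.adjoin K (Set.range ((↑) : s → ℂ)) :=
    hs.1.aevalEquiv.symm.toRingEquiv.trans
      ((MvPolynomial.mapEquiv s σ).trans hs.1.aevalEquiv.toRingEquiv)
  refine ⟨IsAlgClosure.equivOfEquiv ℂ ℂ E, fun x => ?_⟩
  have h1 := IsAlgClosure.equivOfEquiv_algebraMap ℂ ℂ E (algebraMap K _ x)
  have h2 : E (algebraMap K _ x) = algebraMap K _ (σ x) := by
    simp only [E, RingEquiv.trans_apply, AlgEquiv.coe_ringEquiv,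
      AlgEquiv.commutes, MvPolynomial.algebraMap_eq, MvPolynomial.mapEquiv_apply, MvPolynomial.map_C]
    exact hs.1.aevalEquiv.commutes (σ x)
  rw [h2] at h1
  exact h1

theorem exists_ringEquiv_pow_of_isCyclotomicExtension {M u : ℕ} [NeZero M] (hu : u.Coprime M)
    (K : Type*) [Field K] [Algebra ℚ K] [IsCyclotomicExtension {M} ℚ K] :
    ∃ τ : ℂ ≃+* ℂ, ∀ z : ℂ, z ^ M = 1 → τ z = z ^ u := by
  have hζ := IsCyclotomicExtension.zeta_spec M ℚ K
  have := IsCyclotomicExtension.finite {M} ℚ K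
  let φ : K →ₐ[ℚ] ℂ := IsAlgClosed.lift
  let _ : Algebra K ℂ := φ.toRingHom.toAlgebra
  let σ : K ≃ₐ[ℚ] K := IsCyclotomicExtension.fromZetaAut (hζ.pow_of_coprime u hu)
    (Polynomial.cyclotomic.irreducible_rat (NeZero.pos M))
  have hσ : σ (IsCyclotomicExtension.zeta M ℚ K) = IsCyclotomicExtension.zeta M ℚ K ^ u :=
    IsCyclotomicExtension.fromZetaAut_spec _ _
  obtain ⟨τ, hτ⟩ := exists_ringEquiv_extending (K := K) σ.toRingEquiv
  refine ⟨τ, fun z hz => ?_⟩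
  have hζC := hζ.map_of_injective (f := algebraMap K ℂ) (algebraMap K ℂ).injective
  obtain ⟨i, -, rfl⟩ := hζC.eq_pow_of_pow_eq_one hz
  rw [map_pow, hτ]
  have : σ.toRingEquiv (IsCyclotomicExtension.zeta M ℚ K) = IsCyclotomicExtension.zeta M ℚ K ^ u :=
    hσ
  rw [this, map_pow]
  ring

theorem exists_ringEquiv_pow_of_coprime {M u : ℕ} (hM : M ≠ 0) (hu : u.Coprime M) :
    ∃ τ : ℂ ≃+* ℂ, ∀ z : ℂ, z ^ M = 1 → τ z = z ^ u := by
  have : NeZero M := ⟨hM⟩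
  have : NeZero (M : ℚ) := ⟨Nat.cast_ne_zero.mpr hM⟩
  exact @exists_ringEquiv_pow_of_isCyclotomicExtension M u _ hu _ _ _
    (CyclotomicField.isCyclotomicExtension M ℚ)

/-- If `gcd (x, M) = gcd (y, M)` then `y ≡ x u` modulo `M` for some unit `u` modulo `M`. -/
theorem exists_coprime_mul_modEq {M x y : ℕ} (hM : M ≠ 0) (h : x.gcd M = y.gcd M) :
    ∃ u : ℕ, u.Coprime M ∧ x * u ≡ y [MOD M] := by
  have : NeZero M := ⟨hM⟩
  have hd : 0 < x.gcd M := Nat.gcd_pos_of_pos_right _ (NeZero.pos M)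
  set d := x.gcd M with hd_def
  obtain ⟨x', hx⟩ : d ∣ x := Nat.gcd_dvd_left _ _
  obtain ⟨y', hy⟩ : d ∣ y := h ▸ Nat.gcd_dvd_left _ _
  obtain ⟨M', hM'⟩ : d ∣ M := Nat.gcd_dvd_right _ _
  have hx' : x'.Coprime M' := by
    have : d * x'.gcd M' = d * 1 := by rw [← Nat.gcd_mul_left, ← hx, ← hM', mul_one]
    exact Nat.eq_of_mul_eq_mul_left hd this
  have hy' : y'.Coprime M' := by
    have : d * y'.gcd M' = d * 1 := by rw [← Nat.gcd_mul_left, ← hy, ← hM', mul_one, h]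
    exact Nat.eq_of_mul_eq_mul_left hd this
  have hdvd : M' ∣ M := ⟨d, by rw [hM', mul_comm]⟩
  -- After division by d both numbers are units modulo M / d; their ratio lifts to a unit modulo M.
  obtain ⟨u, hu⟩ := ZMod.unitsMap_surjective hdvd
    ((ZMod.unitOfCoprime x' hx')⁻¹ * ZMod.unitOfCoprime y' hy')
  refine ⟨(u : ZMod M).val, ZMod.val_coe_unit_coprime u, ?_⟩
  have h1 : x' * (u : ZMod M).val ≡ y' [MOD M'] := by
    rw [← ZMod.natCast_eq_natCast_iff]
    have h2 := congrArg (Units.val) hu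
    rw [ZMod.unitsMap_val] at h2
    push_cast
    rw [ZMod.natCast_val, h2, Units.val_mul, ← mul_assoc]
    rw [← ZMod.coe_unitOfCoprime x' hx', Units.mul_inv, one_mul, ZMod.coe_unitOfCoprime]
  have h3 := h1.mul_left' d
  rwa [← mul_assoc, ← hx, ← hy, ← hM'] at h3

/-! ### The Davenport–Hasse lifting theorem, by the L-series of `polyChar`. -/

section DavenportHasse

open Polynomial

variable {F : Type*} [Field F]

theorem finite_setOf_monic_natDegree_eq (F : Type*) [Field F] [Finite F] (n : ℕ) :
    {f : F[X] | f.Monic ∧ f.natDegree = n}.Finite := by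
  refine Set.Finite.of_finite_image (f := fun f : F[X] => fun i : Fin (n + 1) => f.coeff i)
    (Set.toFinite _) ?_
  rintro f ⟨-, hf⟩ g ⟨-, hg⟩ hfg
  ext i
  by_cases hi : i < n + 1
  · exact congrFun hfg ⟨i, hi⟩
  · rw [coeff_eq_zero_of_natDegree_lt (by omega), coeff_eq_zero_of_natDegree_lt (by omega)]

/-- The finite set of monic polynomials of degree `n` over a finite field. -/
def monicPolys (F : Type*) [Field F] [Finite F] (n : ℕ) : Finset F[X] :=
  (finite_setOf_monic_natDegree_eq F n).toFinset

theorem mem_monicPolys [Finite F] {n : ℕ} {f : F[X]} :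
    f ∈ monicPolys F n ↔ f.Monic ∧ f.natDegree = n := by
  simp [monicPolys]

/-- The completely multiplicative function `X ^ n - a X ^ (n - 1) + ⋯ + (-1) ^ n b ↦ χ(b) ψ(a)` on
monic polynomials. -/
def polyChar (χ : MulChar F ℂ) (ψ : AddChar F ℂ) (f : F[X]) : ℂ :=
  χ ((-1) ^ f.natDegree * f.coeff 0) * ψ (-f.nextCoeff)

variable (χ : MulChar F ℂ) (ψ : AddChar F ℂ)

theorem polyChar_one : polyChar χ ψ (1 : F[X]) = 1 := by
  rw [polyChar, ← C_1, nextCoeff_C_eq_zero]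
  simp

theorem polyChar_mul {f g : F[X]} (hf : f.Monic) (hg : g.Monic) :
    polyChar χ ψ (f * g) = polyChar χ ψ f * polyChar χ ψ g := by
  rw [polyChar, polyChar, polyChar, hf.natDegree_mul hg, hf.nextCoeff_mul hg, mul_coeff_zero,
    pow_add, mul_mul_mul_comm, map_mul, neg_add, AddChar.map_add_eq_mul]
  ring

theorem polyChar_pow {f : F[X]} (hf : f.Monic) (j : ℕ) :
    polyChar χ ψ (f ^ j) = polyChar χ ψ f ^ j := by
  induction j with
  | zero => simp [polyChar_one]
  | succ j ih => rw [pow_succ, polyChar_mul χ ψ (hf.pow j) hf, ih, pow_succ]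

variable [Finite F]

/-- The sum of `polyChar` over all monic polynomials of degree `n`. -/
def polyCharSum (n : ℕ) : ℂ := ∑ f ∈ monicPolys F n, polyChar χ ψ f

theorem polyCharSum_zero : polyCharSum χ ψ 0 = 1 := by
  have : monicPolys F 0 = {1} := by
    ext f
    rw [mem_monicPolys, Finset.mem_singleton]
    constructor
    · rintro ⟨h1, h2⟩
      exact h1.natDegree_eq_zero.mp h2
    · rintro rfl
      exact ⟨monic_one, natDegree_one⟩
  rw [polyCharSum, this, Finset.sum_singleton, polyChar_one]

theorem polyCharSum_one [Fintype F] : polyCharSum χ ψ 1 = gaussSum χ ψ := by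
  rw [polyCharSum, gaussSum]
  symm
  refine Finset.sum_bij (fun a _ => X - C a) (fun a _ => ?_) (fun a _ b _ h => ?_)
    (fun f hf => ?_) (fun a _ => ?_)
  · exact mem_monicPolys.mpr ⟨monic_X_sub_C a, natDegree_X_sub_C a⟩
  · simpa using h
  · rw [mem_monicPolys] at hf
    refine ⟨-f.coeff 0, Finset.mem_univ _, ?_⟩
    rw [hf.1.eq_X_add_C hf.2]
    simp
  · simp [polyChar, nextCoeff_X_sub_C]

/-- Shifting the coefficient of X^(n-1) permutes the monic polynomials of degree n. For n ≥ 2 it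
leaves the constant term alone, so it only multiplies `polyChar` by a constant, different from 1 for
a suitable shift. Thus the L-series is 1 + G T. -/
theorem polyCharSum_eq_zero (hψ : ψ ≠ 1) {n : ℕ} (hn : 2 ≤ n) : polyCharSum χ ψ n = 0 := by
  obtain ⟨b, hb⟩ := (AddChar.ne_one_iff).mp hψ
  have key : polyCharSum χ ψ n = ψ b * polyCharSum χ ψ n := by
    conv_lhs => rw [polyCharSum]
    rw [polyCharSum, Finset.mul_sum]
    have hdeg : ∀ (a : F) (f : F[X]), f.Monic ∧ f.natDegree = n →
        (f + C a * X ^ (n - 1)).Monic ∧ (f + C a * X ^ (n - 1)).natDegree = n := by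
      rintro a f ⟨h1, h2⟩
      have h3 : (C a * X ^ (n - 1)).degree < f.degree := by
        rw [degree_eq_natDegree h1.ne_zero, h2]
        exact lt_of_le_of_lt (degree_C_mul_X_pow_le _ _) (by exact_mod_cast by omega)
      exact ⟨h1.add_of_left h3, by rw [natDegree_add_eq_left_of_degree_lt h3, h2]⟩
    refine Finset.sum_bij' (fun f _ => f + C b * X ^ (n - 1))
      (fun f _ => f + C (-b) * X ^ (n - 1)) (fun f hf => ?_) (fun f hf => ?_) (fun f _ => ?_)
      (fun f _ => ?_) (fun f hf => ?_)
    · exact mem_monicPolys.mpr (hdeg b f (mem_monicPolys.mp hf))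
    · exact mem_monicPolys.mpr (hdeg (-b) f (mem_monicPolys.mp hf))
    · simp
    · simp
    · rw [mem_monicPolys] at hf
      have h1 := hdeg b f hf
      rw [polyChar, polyChar, h1.2, hf.2, nextCoeff_of_natDegree_pos (p := f) (by omega),
        nextCoeff_of_natDegree_pos (p := f + _) (by omega), h1.2, hf.2, coeff_add, coeff_add, coeff_C_mul_X_pow,
        coeff_C_mul_X_pow, if_neg (by omega), if_pos rfl, add_zero, neg_add,
        AddChar.map_add_eq_mul]
      have h2 : ψ b * (ψ (-f.coeff (n - 1)) * ψ (-b)) = ψ (-f.coeff (n - 1)) := by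
        rw [← AddChar.map_add_eq_mul, ← AddChar.map_add_eq_mul]
        congr 1
        ring
      linear_combination -χ ((-1) ^ n * f.coeff 0) * h2
  have h : (1 - ψ b) * polyCharSum χ ψ n = 0 := by linear_combination key
  exact (mul_eq_zero.mp h).resolve_left (sub_ne_zero.mpr hb.symm)

open Classical in
theorem sum_polyChar_dvd {P : F[X]} (hP : P.Monic) (j n : ℕ) :
    ∑ f ∈ monicPolys F n with P ^ j ∣ f, polyChar χ ψ f =
      if j * P.natDegree ≤ n then
        polyChar χ ψ P ^ j * polyCharSum χ ψ (n - j * P.natDegree) else 0 := by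
  split_ifs with h
  · rw [polyCharSum, Finset.mul_sum]
    symm
    refine Finset.sum_bij (fun g _ => P ^ j * g) (fun g hg => ?_) (fun a _ b _ h => ?_)
      (fun f hf => ?_) (fun g hg => ?_)
    · rw [mem_monicPolys] at hg
      rw [Finset.mem_filter, mem_monicPolys]
      refine ⟨⟨(hP.pow j).mul hg.1, ?_⟩, dvd_mul_right _ _⟩
      rw [(hP.pow j).natDegree_mul hg.1, hP.natDegree_pow, hg.2]
      omega
    · exact mul_left_cancel₀ (hP.pow j).ne_zero h
    · rw [Finset.mem_filter, mem_monicPolys] at hf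
      obtain ⟨⟨h1, h2⟩, g, rfl⟩ := hf
      have hg := (hP.pow j).of_mul_monic_left h1
      refine ⟨g, mem_monicPolys.mpr ⟨hg, ?_⟩, rfl⟩
      rw [(hP.pow j).natDegree_mul hg, hP.natDegree_pow] at h2
      omega
    · rw [polyChar_mul χ ψ (hP.pow j) (mem_monicPolys.mp hg).1, polyChar_pow χ ψ hP]
  · refine Finset.sum_eq_zero fun f hf => absurd ?_ h
    rw [Finset.mem_filter, mem_monicPolys] at hf
    rw [← hf.1.2, ← hP.natDegree_pow]
    exact natDegree_le_of_dvd hf.2 hf.1.1.ne_zero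

/-- The monic irreducible polynomials of degree at most `B`. -/
def monicIrreducibles (F : Type*) [Field F] [Finite F] (B : ℕ) : Finset F[X] :=
  open Classical in
  ((Finset.range (B + 1)).biUnion (monicPolys F)).filter Irreducible

theorem mem_monicIrreducibles {B : ℕ} {f : F[X]} :
    f ∈ monicIrreducibles F B ↔ f.Monic ∧ f.natDegree ≤ B ∧ Irreducible f := by
  simp [monicIrreducibles, mem_monicPolys]
  tauto

open Classical UniqueFactorizationMonoid in
-- The number of j ≥ 1 with P^j ∣ f is the multiplicity of P in f. This plays the role of log n =
-- ∑_{d ∣ n} Λ(d).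
theorem sum_natDegree_of_pow_dvd {f : F[X]} (hf : f.Monic) {B : ℕ} (hB : f.natDegree ≤ B) :
    ∑ P ∈ monicIrreducibles F B, ∑ j ∈ Finset.Icc 1 B,
      (if P ^ j ∣ f then P.natDegree else 0) = f.natDegree := by
  have hf0 := hf.ne_zero
  have hcount : ∀ P ∈ monicIrreducibles F B, ∑ j ∈ Finset.Icc 1 B,
      (if P ^ j ∣ f then P.natDegree else 0) = (normalizedFactors f).count P * P.natDegree := by
    intro P hP
    obtain ⟨h1, h2, h3⟩ := mem_monicIrreducibles.mp hP
    have hdvd : ∀ j, P ^ j ∣ f ↔ j ≤ (normalizedFactors f).count P := by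
      intro j
      rw [pow_dvd_iff_le_emultiplicity, emultiplicity_eq_count_normalizedFactors h3 hf0,
        h1.normalize_eq_self]
      exact Nat.cast_le
    have hle : (normalizedFactors f).count P ≤ B := by
      have h4 := natDegree_le_of_dvd ((hdvd _).mpr le_rfl) hf0
      rw [h1.natDegree_pow] at h4
      exact (Nat.le_mul_of_pos_right _ h3.natDegree_pos).trans (h4.trans hB)
    rw [← Finset.sum_filter, Finset.sum_const, smul_eq_mul]
    congr 1
    rw [show (Finset.Icc 1 B).filter (fun j => P ^ j ∣ f) =
      Finset.Icc 1 ((normalizedFactors f).count P) by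
        ext j; simp only [Finset.mem_filter, Finset.mem_Icc, hdvd]; omega]
    simp
  rw [Finset.sum_congr rfl hcount]
  have hprod : (normalizedFactors f).prod = f := by
    rw [prod_normalizedFactors_eq hf0, hf.normalize_eq_self]
  have hmem : ∀ P ∈ normalizedFactors f, P ∈ monicIrreducibles F B := fun P hP => by
    obtain ⟨h1, h2, h3⟩ := (Polynomial.mem_normalizedFactors_iff hf0).mp hP
    exact mem_monicIrreducibles.mpr ⟨h2, (natDegree_le_of_dvd h3 hf0).trans hB, h1⟩
  conv_rhs => rw [← hprod, natDegree_multiset_prod_of_monic _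
    fun P hP => (mem_monicIrreducibles.mp (hmem P hP)).1]
  rw [Finset.sum_multiset_map_count]
  symm
  refine Finset.sum_subset (fun P hP => hmem P (Multiset.mem_toFinset.mp hP)) fun P _ hP => ?_
  rw [Multiset.count_eq_zero_of_notMem (fun h => hP (Multiset.mem_toFinset.mpr h)), zero_smul]

/-- The sum of `deg (P) λ(P) ^ j` over the monic irreducible `P` and the `j ≥ 1` with
`j deg (P) = m`, where `λ = polyChar χ ψ`; the bound `B ≥ m` makes the sum visibly finite. -/
def primePowerSum (B m : ℕ) : ℂ :=
  ∑ P ∈ monicIrreducibles F B, ∑ j ∈ Finset.Icc 1 B,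
    if j * P.natDegree = m then P.natDegree * polyChar χ ψ P ^ j else 0

/-- The logarithmic derivative of the Euler product, read off coefficientwise: replace n = deg f by
the sum of deg P over the prime powers dividing f, and exchange summations. -/
theorem natCast_mul_polyCharSum {B n : ℕ} (hn : n ≤ B) :
    n * polyCharSum χ ψ n = ∑ P ∈ monicIrreducibles F B, ∑ j ∈ Finset.Icc 1 B,
      if j * P.natDegree ≤ n then
        P.natDegree * polyChar χ ψ P ^ j * polyCharSum χ ψ (n - j * P.natDegree) else 0 := by
  classical
  have h1 : n * polyCharSum χ ψ n = ∑ f ∈ monicPolys F n, ∑ P ∈ monicIrreducibles F B,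
      ∑ j ∈ Finset.Icc 1 B, P.natDegree * (if P ^ j ∣ f then polyChar χ ψ f else 0) := by
    rw [polyCharSum, Finset.mul_sum]
    refine Finset.sum_congr rfl fun f hf => ?_
    obtain ⟨hf1, hf2⟩ := mem_monicPolys.mp hf
    have h2 := congrArg (Nat.cast (R := ℂ)) (sum_natDegree_of_pow_dvd hf1 (hf2.trans_le hn))
    rw [hf2] at h2
    rw [← h2, Nat.cast_sum, Finset.sum_mul]
    refine Finset.sum_congr rfl fun P _ => ?_
    rw [Nat.cast_sum, Finset.sum_mul]
    refine Finset.sum_congr rfl fun j _ => ?_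
    split_ifs <;> simp
  rw [h1, Finset.sum_comm]
  refine Finset.sum_congr rfl fun P hP => ?_
  rw [Finset.sum_comm]
  refine Finset.sum_congr rfl fun j _ => ?_
  rw [← Finset.mul_sum, ← Finset.sum_filter,
    sum_polyChar_dvd χ ψ (mem_monicIrreducibles.mp hP).1]
  split_ifs
  · ring
  · simp

theorem primePowerSum_one [Fintype F] {B : ℕ} (hB : 1 ≤ B) :
    primePowerSum χ ψ B 1 = gaussSum χ ψ := by
  have h := natCast_mul_polyCharSum χ ψ hB
  rw [polyCharSum_one, Nat.cast_one, one_mul] at h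
  rw [h, primePowerSum]
  refine Finset.sum_congr rfl fun P hP => Finset.sum_congr rfl fun j hj => ?_
  have h1 := (mem_monicIrreducibles.mp hP).2.2.natDegree_pos
  have h2 : 0 < j * P.natDegree := Nat.mul_pos (Finset.mem_Icc.mp hj).1 h1
  by_cases h3 : j * P.natDegree = 1
  · rw [if_pos h3, if_pos h3.le, h3, Nat.sub_self, polyCharSum_zero, mul_one]
  · rw [if_neg h3, if_neg (by omega)]

/-- The coefficients of the L-series are 1, G, 0, 0, …, so in the recursion for degree n + 1 ≥ 2 the
left side is zero and only prime powers of degree n + 1 and n survive. -/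
theorem primePowerSum_succ [Fintype F] (hψ : ψ ≠ 1) {B n : ℕ} (hn : n + 1 ≤ B) (hn1 : 1 ≤ n) :
    primePowerSum χ ψ B (n + 1) = -gaussSum χ ψ * primePowerSum χ ψ B n := by
  have h := natCast_mul_polyCharSum χ ψ hn
  rw [polyCharSum_eq_zero χ ψ hψ (by omega), mul_zero] at h
  have h4 : primePowerSum χ ψ B (n + 1) + gaussSum χ ψ * primePowerSum χ ψ B n = 0 := by
    rw [h, primePowerSum, primePowerSum, Finset.mul_sum, ← Finset.sum_add_distrib]
    refine Finset.sum_congr rfl fun P hP => ?_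
    rw [Finset.mul_sum, ← Finset.sum_add_distrib]
    refine Finset.sum_congr rfl fun j hj => ?_
    rcases lt_trichotomy (j * P.natDegree) n with h3 | h3 | h3
    · rw [if_neg (by omega), if_neg (by omega), if_pos (by omega),
        polyCharSum_eq_zero χ ψ hψ (by omega)]
      simp
    · rw [if_neg (by omega), if_pos h3, if_pos (by omega), h3, Nat.add_sub_cancel_left,
        polyCharSum_one]
      ring
    · rw [if_neg (by omega : ¬ j * P.natDegree = n)]
      by_cases h5 : j * P.natDegree = n + 1
      · rw [if_pos h5, if_pos h5.le, h5, Nat.sub_self, polyCharSum_zero]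
        ring
      · rw [if_neg h5, if_neg (by omega)]
        simp
  linear_combination h4

theorem primePowerSum_eq [Fintype F] (hψ : ψ ≠ 1) {B n : ℕ} (hn : n + 1 ≤ B) :
    primePowerSum χ ψ B (n + 1) = (-1) ^ n * gaussSum χ ψ ^ (n + 1) := by
  induction n with
  | zero => rw [primePowerSum_one χ ψ hn]; simp
  | succ n ih =>
    rw [primePowerSum_succ χ ψ hψ hn (by omega), ih (by omega)]
    ring

open Classical in
-- An irreducible P has a root in K exactly when its degree divides [K : F]; it then splits in K,
-- and separability makes the roots distinct.
theorem card_filter_minpoly_eq {K : Type*} [Field K] [Fintype K] [Algebra F K] {P : F[X]}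
    (hP : P.Monic) (hirr : Irreducible P) :
    (Finset.univ.filter fun x : K => minpoly F x = P).card =
      if P.natDegree ∣ Module.finrank F K then P.natDegree else 0 := by
  split_ifs with h
  · have hsplit : (P.map (algebraMap F K)).Splits := by
      have h1 := map_dvd (mapRingHom (algebraMap F K))
        (hirr.natDegree_dvd_iff_dvd_X_pow_card_pow_sub_X.mp h)
      have h2 : Nat.card F ^ Module.finrank F K = Fintype.card K := by
        rw [← Nat.card_eq_fintype_card, ← Module.natCard_eq_pow_finrank]
      rw [h2] at h1
      simp only [coe_mapRingHom, Polynomial.map_sub, Polynomial.map_pow, map_X] at h1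
      refine Splits.of_dvd ?_ (FiniteField.X_pow_card_sub_X_ne_zero K Fintype.one_lt_card) h1
      rw [splits_iff_card_roots, FiniteField.roots_X_pow_card_sub_X,
        FiniteField.X_pow_card_sub_X_natDegree_eq K Fintype.one_lt_card]
      rfl
    rw [← card_rootSet_eq_natDegree (PerfectField.separable_of_irreducible hirr) hsplit,
      ← Set.toFinset_card]
    congr 1
    ext x
    rw [Finset.mem_filter, Set.mem_toFinset, mem_rootSet_of_ne hP.ne_zero]
    constructor
    · rintro ⟨-, rfl⟩
      exact minpoly.aeval F x
    · intro hx
      exact ⟨Finset.mem_univ _, (minpoly.eq_of_irreducible_of_monic hirr hx hP).symm⟩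
  · rw [Finset.card_eq_zero, Finset.filter_eq_empty_iff]
    rintro x - rfl
    exact h (minpoly.degree_dvd (.of_finite F x))

omit [Finite F] in
-- Norm and trace from K factor through F(x), where they are coefficients of the minimal polynomial
-- up to sign; the exponent is [K : F(x)].
theorem mulChar_norm_mul_addChar_trace {K : Type*} [Field K] [Finite K] [Algebra F K] (x : K) :
    χ (Algebra.norm F x) * ψ (Algebra.trace F K x) =
      polyChar χ ψ (minpoly F x) ^ (Module.finrank F K / (minpoly F x).natDegree) := by
  have hx : IsIntegral F x := .of_finite F x
  have h1 : Module.finrank F K / (minpoly F x).natDegree =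
      Module.finrank (IntermediateField.adjoin F {x}) K := by
    rw [← Module.finrank_mul_finrank F (IntermediateField.adjoin F {x}) K,
      IntermediateField.adjoin.finrank hx, Nat.mul_div_cancel_left _ (minpoly.natDegree_pos hx)]
  have h2 : Algebra.norm F (IntermediateField.AdjoinSimple.gen F x) =
      (-1) ^ (minpoly F x).natDegree * (minpoly F x).coeff 0 := by
    have h3 := Algebra.PowerBasis.norm_gen_eq_coeff_zero_minpoly
      (IntermediateField.adjoin.powerBasis hx)
    rwa [IntermediateField.adjoin.powerBasis_gen, IntermediateField.minpoly_gen,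
      IntermediateField.adjoin.powerBasis_dim] at h3
  rw [h1, trace_eq_finrank_mul_minpoly_nextCoeff, Algebra.norm_eq_norm_adjoin, h2, polyChar,
    map_pow, mul_pow, ← AddChar.map_nsmul_eq_pow, nsmul_eq_mul]

/-- The Davenport–Hasse theorem on lifted Gauss sums. -/
theorem sum_mulChar_norm_mul_addChar_trace [Fintype F] {K : Type*} [Field K] [Fintype K]
    [Algebra F K] (hψ : ψ ≠ 1) :
    ∑ x : K, χ (Algebra.norm F x) * ψ (Algebra.trace F K x) =
      (-1) ^ (Module.finrank F K - 1) * gaussSum χ ψ ^ Module.finrank F K := by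
  classical
  set s := Module.finrank F K with hs
  have hs0 : 0 < s := Module.finrank_pos
  obtain ⟨n, hn⟩ : ∃ n, s = n + 1 := ⟨s - 1, by omega⟩
  have h1 := primePowerSum_eq χ ψ hψ (B := s) hn.ge
  rw [← hn] at h1
  rw [show s - 1 = n by omega, ← h1, primePowerSum]
  have hmem : ∀ x ∈ (Finset.univ : Finset K), minpoly F x ∈ monicIrreducibles F s := fun x _ => by
    have hx : IsIntegral F x := .of_finite F x
    exact mem_monicIrreducibles.mpr
      ⟨minpoly.monic hx, Nat.le_of_dvd hs0 (minpoly.degree_dvd hx), minpoly.irreducible hx⟩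
  -- Group the x by minimal polynomial. A P of degree d ∣ s accounts for d elements, each
  -- contributing λ(P)^(s/d), which is its share of the prime power sum of degree s.
  rw [← Finset.sum_fiberwise_of_maps_to hmem]
  refine Finset.sum_congr rfl fun P hP => ?_
  obtain ⟨hP1, hP2, hP3⟩ := mem_monicIrreducibles.mp hP
  have h2 : ∀ x ∈ Finset.univ.filter (fun x : K => minpoly F x = P),
      χ (Algebra.norm F x) * ψ (Algebra.trace F K x) =
        polyChar χ ψ P ^ (s / P.natDegree) := by
    intro x hx
    rw [mulChar_norm_mul_addChar_trace, (Finset.mem_filter.mp hx).2]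
  rw [Finset.sum_congr rfl h2, Finset.sum_const, card_filter_minpoly_eq hP1 hP3, ← hs]
  have hd := hP3.natDegree_pos
  split_ifs with h
  · obtain ⟨j, hj⟩ := h
    have hj1 : s / P.natDegree = j := by rw [hj, Nat.mul_div_cancel_left _ hd]
    have hj0 : 0 < j := Nat.pos_of_ne_zero (by rintro rfl; omega)
    rw [Finset.sum_eq_single j, if_pos (by rw [hj, mul_comm]), nsmul_eq_mul, hj1]
    · intro i _ hi
      rw [if_neg]
      intro h3
      rw [hj, mul_comm] at h3
      exact hi (Nat.eq_of_mul_eq_mul_left hd h3)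
    · intro h3
      exact absurd (Finset.mem_Icc.mpr ⟨hj0, hj ▸ Nat.le_mul_of_pos_left _ hd⟩) h3
  · rw [zero_smul]
    symm
    refine Finset.sum_eq_zero fun j _ => if_neg fun h3 => h ⟨j, by rw [← h3, mul_comm]⟩

end DavenportHasse

/-! ### Gauss sums indexed by the value of the character at a primitive root. -/

section GaussSums

variable (p : ℕ) [Fact p.Prime] {F : Type*} [Field F] [Fintype F] [Algebra (ZMod p) F]

/-- `canonicalChar p` as an additive character. -/
def canonicalAddChar (F : Type*) [Field F] [Algebra (ZMod p) F] : AddChar F ℂ :=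
  ZMod.stdAddChar.compAddMonoidHom (Algebra.trace (ZMod p) F).toAddMonoidHom

omit [Fintype F] in
theorem canonicalAddChar_apply (x : F) : canonicalAddChar p F x = canonicalChar p x := rfl

omit [Fintype F] in
theorem canonicalChar_pow (x : F) : canonicalChar p x ^ p = 1 := by
  rw [← canonicalAddChar_apply, ← AddChar.map_nsmul_eq_pow]
  have : CharP F p := charP_of_injective_algebraMap (algebraMap (ZMod p) F).injective p
  simp

theorem canonicalAddChar_ne_one : canonicalAddChar p F ≠ 1 := by
  obtain ⟨x, hx⟩ := Algebra.trace_surjective (ZMod p) F 1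
  refine AddChar.ne_one_iff.mpr ⟨x, ?_⟩
  have h : canonicalAddChar p F x = ZMod.stdAddChar (1 : ZMod p) := by
    rw [canonicalAddChar_apply, canonicalChar, hx]
  rw [h]
  intro h1
  exact one_ne_zero (ZMod.injective_stdAddChar (h1.trans (AddChar.map_zero_eq_one _).symm))

/-- The Gauss sum of the multiplicative character that takes the value `z` at `γ`. -/
def gammaSum (γ : Fˣ) (z : ℂ) : ℂ :=
  ∑ n ∈ Finset.range (Fintype.card F - 1), z ^ n * canonicalChar p ((γ : F) ^ n)

theorem coprime_of_dvd_card_sub_one {N : ℕ} (hN : N ∣ Fintype.card F - 1) : N.Coprime p := by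
  have hp : p.Prime := Fact.out
  have : CharP F p := charP_of_injective_algebraMap (algebraMap (ZMod p) F).injective p
  obtain ⟨n, -, hn⟩ := FiniteField.card F p
  refine ((Nat.Prime.coprime_iff_not_dvd hp).mpr fun hd => ?_).symm
  have h1 : p ∣ Fintype.card F - 1 := hd.trans hN
  have h2 : p ∣ Fintype.card F := hn ▸ dvd_pow_self p n.ne_zero
  have h3 := (Nat.dvd_sub_iff_right Fintype.one_lt_card.le h2).mp h1
  exact hp.one_lt.ne' (Nat.dvd_one.mp h3)

variable {γ : Fˣ} (hγ : Subgroup.zpowers γ = ⊤)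

include hγ

omit [Algebra (ZMod p) F] in
theorem orderOf_eq_of_zpowers_eq_top : orderOf γ = Fintype.card F - 1 := by
  classical
  rw [← Nat.card_zpowers, hγ, Subgroup.card_top, Nat.card_eq_fintype_card, Fintype.card_units]

omit [Algebra (ZMod p) F] in
theorem exists_pow_eq_of_ne_zero {x : F} (hx : x ≠ 0) :
    ∃ n < Fintype.card F - 1, (γ : F) ^ n = x := by
  classical
  have h : Units.mk0 x hx ∈ Subgroup.zpowers γ := hγ ▸ Subgroup.mem_top _
  rw [mem_zpowers_iff_mem_range_orderOf, orderOf_eq_of_zpowers_eq_top hγ] at h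
  obtain ⟨n, hn, hn'⟩ := Finset.mem_image.mp h
  refine ⟨n, Finset.mem_range.mp hn, ?_⟩
  have := congrArg Units.val hn'
  simpa using this

omit [Algebra (ZMod p) F] in
theorem pow_eq_pow_iff_of_zpowers_eq_top {m n : ℕ} :
    (γ : F) ^ m = (γ : F) ^ n ↔ m ≡ n [MOD (Fintype.card F - 1)] := by
  rw [← orderOf_eq_of_zpowers_eq_top hγ, ← pow_eq_pow_iff_modEq, ← Units.val_inj]
  simp

omit [Algebra (ZMod p) F] in
open Classical in
theorem sum_ne_zero_eq_sum_range (f : F → ℂ) :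
    ∑ x : F with x ≠ 0, f x = ∑ n ∈ Finset.range (Fintype.card F - 1), f ((γ : F) ^ n) := by
  symm
  refine Finset.sum_bij (fun n _ => (γ : F) ^ n) (fun n _ => ?_) (fun m hm n hn h => ?_)
    (fun x hx => ?_) (fun n _ => rfl)
  · simp
  · rw [pow_eq_pow_iff_of_zpowers_eq_top hγ] at h
    exact Nat.ModEq.eq_of_lt_of_lt h (Finset.mem_range.mp hm) (Finset.mem_range.mp hn)
  · obtain ⟨n, hn, h⟩ := exists_pow_eq_of_ne_zero hγ (Finset.mem_filter.mp hx).2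
    exact ⟨n, Finset.mem_range.mpr hn, h⟩

theorem gaussS_eq_gammaSum {χ : F → ℂ} {z : ℂ} (hχ : ∀ n : ℕ, χ ((γ : F) ^ n) = z ^ n) :
    gaussS p χ = gammaSum p γ z := by
  rw [gaussS, sum_ne_zero_eq_sum_range hγ, gammaSum]
  exact Finset.sum_congr rfl fun n _ => by rw [hχ]

omit [Algebra (ZMod p) F] in
theorem exists_mulChar_apply_eq {z : ℂ} (hz : z ^ (Fintype.card F - 1) = 1) :
    ∃ χ : MulChar F ℂ, χ γ = z := by
  classical
  have hz0 : z ≠ 0 := by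
    rintro rfl
    rw [zero_pow (by have := Fintype.one_lt_card (α := F); omega)] at hz
    exact zero_ne_one hz
  have h1 : Units.mk0 z hz0 ∈ rootsOfUnity (Fintype.card Fˣ) ℂ := by
    rw [mem_rootsOfUnity, Fintype.card_units]
    ext
    simpa using hz
  refine ⟨MulChar.ofRootOfUnity h1 (g := γ) (fun x => hγ ▸ Subgroup.mem_top x), ?_⟩
  rw [MulChar.ofRootOfUnity_spec]
  rfl

theorem gaussSum_eq_gammaSum (χ : MulChar F ℂ) :
    gaussSum χ (canonicalAddChar p F) = gammaSum p γ (χ γ) := by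
  classical
  rw [← gaussS_eq_gammaSum p hγ (χ := χ) (fun n => map_pow χ _ _), gaussSum, gaussS]
  symm
  refine Finset.sum_filter_of_ne fun x _ hx => ?_
  rintro rfl
  rw [MulChar.map_zero, zero_mul] at hx
  exact hx rfl

omit [Fintype F] [Algebra (ZMod p) F] hγ in
theorem mulChar_ne_one {χ : MulChar F ℂ} (hχ : χ γ ≠ 1) : χ ≠ 1 := by
  rintro rfl
  exact hχ (MulChar.one_apply_coe γ)

theorem gammaSum_ne_zero {z : ℂ} (hz : z ^ (Fintype.card F - 1) = 1) (hz1 : z ≠ 1) :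
    gammaSum p γ z ≠ 0 := by
  obtain ⟨χ, rfl⟩ := exists_mulChar_apply_eq hγ hz
  rw [← gaussSum_eq_gammaSum p hγ]
  exact gaussSum_ne_zero_of_nontrivial (by simp) (mulChar_ne_one hz1)
    (AddChar.IsPrimitive.of_ne_one (canonicalAddChar_ne_one p))

theorem gammaSum_one : gammaSum p γ 1 = -1 := by
  have h := gaussSum_eq_gammaSum p hγ 1
  rw [gaussSum_one_left (canonicalAddChar_ne_one p), MulChar.one_apply_coe] at h
  exact h.symm

/-- The square of the quadratic Gauss sum is χ(-1) q; a further squaring removes the sign. -/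
theorem gammaSum_neg_one_pow_four (h2 : 2 ∣ Fintype.card F - 1) :
    gammaSum p γ (-1) ^ 4 = (Fintype.card F : ℂ) ^ 2 := by
  obtain ⟨m, hm⟩ := h2
  obtain ⟨χ, hχ⟩ := exists_mulChar_apply_eq hγ (z := -1) (by rw [hm, pow_mul]; simp)
  have h3 : ∀ x : F, x ≠ 0 → χ x = 1 ∨ χ x = -1 := fun x hx => by
    obtain ⟨n, -, rfl⟩ := exists_pow_eq_of_ne_zero hγ hx
    rw [map_pow, hχ]
    exact neg_one_pow_eq_or ℂ n
  have h4 : χ.IsQuadratic := fun x => by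
    by_cases hx : x = 0
    · exact Or.inl (by rw [hx, MulChar.map_zero])
    · exact Or.inr (h3 x hx)
  have h5 := gaussSum_sq (mulChar_ne_one (χ := χ) (by rw [hχ]; norm_num)) h4
    (AddChar.IsPrimitive.of_ne_one (canonicalAddChar_ne_one p (F := F)))
  rw [gaussSum_eq_gammaSum p hγ, hχ] at h5
  have h6 : χ (-1) ^ 2 = 1 := by
    rcases h3 (-1) (by simp) with h | h <;> rw [h] <;> norm_num
  calc gammaSum p γ (-1) ^ 4 = (gammaSum p γ (-1) ^ 2) ^ 2 := by ring
    _ = χ (-1) ^ 2 * (Fintype.card F : ℂ) ^ 2 := by rw [h5]; ring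
    _ = _ := by rw [h6, one_mul]

omit hγ in
-- An automorphism fixing ζ_p leaves the additive character unchanged and conjugates only the
-- multiplicative one.
theorem map_gammaSum {τ : ℂ ≃+* ℂ} (hτ : ∀ z : ℂ, z ^ p = 1 → τ z = z) (z : ℂ) :
    τ (gammaSum p γ z) = gammaSum p γ (τ z) := by
  rw [gammaSum, gammaSum, map_sum]
  exact Finset.sum_congr rfl fun n _ => by
    rw [map_mul, map_pow, hτ _ (canonicalChar_pow p _)]

/-- Davenport–Hasse for χ ∘ Norm, whose value at ω is z^y. -/
theorem gammaSum_lift {F' : Type*} [Field F'] [Fintype F'] [Algebra (ZMod p) F'] [Algebra F F']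
    {ω : F'ˣ} (hω : Subgroup.zpowers ω = ⊤) {y : ℕ} (hy : Algebra.norm F (ω : F') = (γ : F) ^ y)
    {z : ℂ} (hz : z ^ (Fintype.card F - 1) = 1) :
    gammaSum p ω (z ^ y) =
      (-1) ^ (Module.finrank F F' - 1) * gammaSum p γ z ^ Module.finrank F F' := by
  classical
  obtain ⟨χ, rfl⟩ := exists_mulChar_apply_eq hγ hz
  have : IsScalarTower (ZMod p) F F' :=
    IsScalarTower.of_algebraMap_eq' (Subsingleton.elim _ _)
  have h := sum_mulChar_norm_mul_addChar_trace χ (canonicalAddChar p F) (K := F')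
    (canonicalAddChar_ne_one p)
  rw [gaussSum_eq_gammaSum p hγ] at h
  rw [← h, ← gaussS_eq_gammaSum p hω (χ := fun x => χ (Algebra.norm F x))
    (fun n => by rw [map_pow, map_pow, hy, map_pow]), gaussS]
  have h1 : ∀ x : F', canonicalAddChar p F (Algebra.trace F F' x) = canonicalChar p x := fun x => by
    rw [canonicalAddChar_apply, canonicalChar, canonicalChar, Algebra.trace_trace]
  simp only [h1]
  refine Finset.sum_filter_of_ne fun x _ hx => ?_
  rintro rfl
  rw [Algebra.norm_zero, MulChar.map_zero, zero_mul] at hx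
  exact hx rfl

end GaussSums

/-! ### Invariance of Gauss sums with constant (r-1)-st power under z ↦ z^r. -/

section Purity

theorem exists_modEq_of_gcd_dvd {N M r : ℕ} (hr : 1 ≤ r) (hrN : r.Coprime N)
    (h : N.gcd M ∣ r - 1) :
    ∃ u : ℕ, u ≡ r [MOD N] ∧ u ≡ 1 [MOD M] ∧ u.Coprime (N * M) := by
  obtain ⟨u, hu1, hu2⟩ := Nat.chineseRemainder' (n := N) (m := M) (a := r) (b := 1)
    ((Nat.modEq_iff_dvd' hr).mpr h).symm
  refine ⟨u, hu1, hu2, Nat.Coprime.mul_right ?_ ?_⟩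
  · rwa [Nat.Coprime, hu1.gcd_eq]
  · rw [Nat.Coprime, hu2.gcd_eq, Nat.gcd_one_left]

variable (p : ℕ) [Fact p.Prime] {F : Type*} [Field F] [Fintype F] [Algebra (ZMod p) F]
variable {γ : Fˣ} (hγ : Subgroup.zpowers γ = ⊤)

/-- Take τ acting as x ↦ x^r on N-th and trivially on M-th roots of unity, which is consistent
because gcd(N, M) ∣ r - 1. It fixes ζ_p, the root of unity G(z)/R and R, hence G(z); but it sends
G(z) to G(z^r). -/
theorem gammaSum_pow_eq_of_reference {r N M E : ℕ} (hr : 1 ≤ r) (hrN : r.Coprime N) (hN : N ≠ 0)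
    (hM : M ≠ 0) (hgcd : N.gcd M ∣ r - 1) (hpM : p ∣ M) (hEM : E ∣ M) {R z : ℂ} (hR : R ≠ 0)
    (hRfix : ∀ τ : ℂ ≃+* ℂ, (∀ x : ℂ, x ^ N = 1 → τ x = x ^ r) → (∀ x : ℂ, x ^ M = 1 → τ x = x) →
      τ R = R)
    (hz : z ^ N = 1) (hE : (gammaSum p γ z / R) ^ E = 1) :
    gammaSum p γ (z ^ r) = gammaSum p γ z := by
  obtain ⟨u, hu1, hu2, hu⟩ := exists_modEq_of_gcd_dvd hr hrN hgcd
  obtain ⟨τ, hτ⟩ := exists_ringEquiv_pow_of_coprime (mul_ne_zero hN hM) hu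
  have h1 : ∀ x : ℂ, x ^ N = 1 → τ x = x ^ r := fun x hx => by
    rw [hτ x (by rw [pow_mul, hx, one_pow]), pow_eq_pow_of_modEq hu1 hx]
  have h2 : ∀ x : ℂ, x ^ M = 1 → τ x = x := fun x hx => by
    rw [hτ x (by rw [mul_comm, pow_mul, hx, one_pow]),
      pow_eq_pow_of_modEq hu2 hx, pow_one]
  have h3 : ∀ {m : ℕ} {x : ℂ}, m ∣ M → x ^ m = 1 → τ x = x := fun hm hx => by
    obtain ⟨l, rfl⟩ := hm
    exact h2 _ (by rw [pow_mul, hx, one_pow])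
  have h4 : gammaSum p γ z = gammaSum p γ z / R * R := (div_mul_cancel₀ _ hR).symm
  rw [← h1 z hz, ← map_gammaSum p (fun x hx => h3 hpM hx), h4, map_mul, h3 hEM hE, hRfix τ h1 h2]

include hγ

theorem gammaSum_pow_eq {r N : ℕ} (hr : 2 ≤ r) (hrN : r.Coprime N)
    (hN : N ∣ Fintype.card F - 1) {c : ℂ} (hc : c ^ 2 = (Fintype.card F : ℂ) ^ (r - 1))
    (h : ∀ z : ℂ, z ^ N = 1 → z ≠ 1 → gammaSum p γ z ^ (r - 1) = c) {z : ℂ} (hz : z ^ N = 1) :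
    gammaSum p γ (z ^ r) = gammaSum p γ z := by
  have hp : p.Prime := Fact.out
  by_cases hz1 : z = 1
  · rw [hz1, one_pow]
  have hq : 1 < Fintype.card F := Fintype.one_lt_card
  have hN0 : N ≠ 0 := by
    rintro rfl
    have := Nat.eq_zero_of_zero_dvd hN
    omega
  have hcard : (Fintype.card F : ℂ) ≠ 0 := by simp
  have : CharP F p := charP_of_injective_algebraMap (algebraMap (ZMod p) F).injective p
  obtain ⟨n, -, hn⟩ := FiniteField.card F p
  have hpN : N.Coprime p := coprime_of_dvd_card_sub_one p hN
  have hc0 : c ≠ 0 := by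
    rintro rfl
    rw [zero_pow two_ne_zero] at hc
    exact pow_ne_zero _ hcard hc.symm
  have hfix : ∀ m : ℕ, ∀ τ : ℂ ≃+* ℂ, (∀ x : ℂ, x ^ (p * m) = 1 → τ x = x) →
      τ (gammaSum p γ (-1)) = gammaSum p γ (-1) := fun m τ hτ => by
    rw [map_gammaSum p (fun x hx => hτ x (by rw [pow_mul, hx, one_pow])), map_neg, map_one]
  -- For N even, -1 is an N-th root of unity, so G(-1)^(r-1) = c as well, and R = G(-1) serves with
  -- ratios of order dividing r - 1.
  by_cases hN2 : 2 ∣ N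
  · have h1 : ((-1 : ℂ)) ^ N = 1 := by
      obtain ⟨m, rfl⟩ := hN2
      rw [pow_mul]
      simp
    have hR := h (-1) h1 (by norm_num)
    refine gammaSum_pow_eq_of_reference p (M := p * (r - 1)) (E := r - 1) (R := gammaSum p γ (-1))
      (by omega) hrN hN0 (mul_ne_zero hp.ne_zero (by omega)) ?_ (dvd_mul_right _ _)
      (dvd_mul_left _ _) ?_ (fun τ _ => hfix _ τ) hz ?_
    · rw [hpN.symm.gcd_mul_left_cancel_right]
      exact Nat.gcd_dvd_right _ _
    · intro h0
      rw [h0, zero_pow (by omega)] at hR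
      exact hc0 hR.symm
    · rw [div_pow, hR, h z hz hz1, div_self hc0]
  -- For N odd, powers of 2 in M cost nothing. It is enough that R^4 = q^2: since c^4 = q^(2(r-1)),
  -- the ratio has order dividing 4(r-1). The factor 8 in M also leaves room for an R built from
  -- eighth roots of unity.
  · have hN2' : N.Coprime 2 := ((Nat.Prime.coprime_iff_not_dvd Nat.prime_two).mpr hN2).symm
    have hred : ∀ R : ℂ, R ^ 4 = (Fintype.card F : ℂ) ^ 2 →
        (∀ τ : ℂ ≃+* ℂ, (∀ x : ℂ, x ^ (p * 8) = 1 → τ x = x) → τ R = R) →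
        gammaSum p γ (z ^ r) = gammaSum p γ z := by
      intro R hR hRfix
      have hR0 : R ≠ 0 := by
        rintro rfl
        rw [zero_pow (by norm_num)] at hR
        exact pow_ne_zero 2 hcard hR.symm
      refine gammaSum_pow_eq_of_reference p (M := p * (2 ^ 3 * (r - 1))) (E := 2 ^ 2 * (r - 1))
        (R := R) (by omega) hrN hN0 (mul_ne_zero hp.ne_zero (by omega)) ?_ (dvd_mul_right _ _)
        ?_ hR0 (fun τ _ hτ => hRfix τ fun x hx => hτ x ?_) hz ?_
      · rw [hpN.symm.gcd_mul_left_cancel_right, (hN2'.pow_right 3).symm.gcd_mul_left_cancel_right]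
        exact Nat.gcd_dvd_right _ _
      · exact Dvd.intro (p * 2) (by ring)
      · rw [show p * (2 ^ 3 * (r - 1)) = p * 8 * (r - 1) by ring, pow_mul, hx, one_pow]
      · rw [div_pow, pow_mul R, show (2 : ℕ) ^ 2 = 4 by norm_num, hR, mul_comm 4 (r - 1), pow_mul,
          h z hz hz1, show c ^ 4 = (c ^ 2) ^ 2 by ring, hc, ← pow_mul, ← pow_mul,
          mul_comm, div_self (pow_ne_zero _ hcard)]
    rcases hp.eq_two_or_odd' with rfl | hodd
    -- For p = 2 there is no quadratic character; ξ + ξ^7 = ξ + ξ⁻¹ is a square root of 2 and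
    -- replaces the quadratic Gauss sum.
    · obtain ⟨ξ, hξ⟩ : ∃ ξ : ℂ, IsPrimitiveRoot ξ 8 :=
        ⟨_, Complex.isPrimitiveRoot_exp 8 (by norm_num)⟩
      have h8 : ξ ^ 8 = 1 := hξ.pow_eq_one
      have h4 : ξ ^ 4 = -1 := by
        have h5 : (ξ ^ 4 - 1) * (ξ ^ 4 + 1) = 0 := by linear_combination h8
        rcases mul_eq_zero.mp h5 with h6 | h6
        · exact absurd (sub_eq_zero.mp h6) (hξ.pow_ne_one_of_pos_of_lt (by norm_num) (by norm_num))
        · exact eq_neg_of_add_eq_zero_left h6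
      refine hred ((ξ + ξ ^ 7) ^ (n : ℕ)) ?_ fun τ hτ => ?_
      · have h5 : (ξ + ξ ^ 7) ^ 4 = 2 ^ 2 := by
          have h6 : (ξ + ξ ^ 7) ^ 2 = 2 := by
            linear_combination ξ ^ 2 * (ξ ^ 8 - ξ ^ 4 + 1) * h4 + 2 * h8
          calc (ξ + ξ ^ 7) ^ 4 = ((ξ + ξ ^ 7) ^ 2) ^ 2 := by ring
            _ = _ := by rw [h6]
        rw [← pow_mul, mul_comm, pow_mul, h5, hn, ← pow_mul]
        push_cast
        rw [← pow_mul, mul_comm]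
      · rw [map_pow, map_add, map_pow, hτ ξ (by rw [mul_comm, pow_mul, h8, one_pow])]
    · refine hred (gammaSum p γ (-1)) (gammaSum_neg_one_pow_four p hγ ?_) (hfix 8)
      rw [hn]
      exact (Nat.Odd.sub_odd hodd.pow odd_one).two_dvd

end Purity

/-! ### Finite Fourier analysis and Gauss periods. -/

section Periods

theorem IsPrimitiveRoot.sum_pow_mul {ζ : ℂ} {n : ℕ} (hζ : IsPrimitiveRoot ζ n) (x : ℕ) :
    ∑ s ∈ Finset.range n, (ζ ^ x) ^ s = if n ∣ x then (n : ℂ) else 0 := by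
  split_ifs with h
  · simp [(hζ.pow_eq_one_iff_dvd x).mpr h]
  · have h1 : ζ ^ x ≠ 1 := fun h1 => h ((hζ.pow_eq_one_iff_dvd x).mp h1)
    have h2 := mul_neg_geom_sum (ζ ^ x) n
    rw [← pow_mul, mul_comm x n, pow_mul, hζ.pow_eq_one, one_pow, sub_self] at h2
    exact (mul_eq_zero.mp h2).resolve_left (sub_ne_zero.mpr h1.symm)

theorem IsPrimitiveRoot.sum_pow_mul_inv_pow {ζ : ℂ} {n : ℕ} (hζ : IsPrimitiveRoot ζ n)
    (hn : n ≠ 0) (x y : ℕ) :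
    ∑ s ∈ Finset.range n, ζ ^ (s * x) * (ζ⁻¹ ^ s) ^ y = if y ≡ x [MOD n] then (n : ℂ) else 0 := by
  have h0 : ζ ≠ 0 := hζ.ne_zero hn
  have h1 : ∀ s, ζ ^ (s * x) * (ζ⁻¹ ^ s) ^ y = (ζ ^ (x + (n - 1) * y)) ^ s := by
    intro s
    have h2 : ζ⁻¹ = ζ ^ (n - 1) := by
      rw [inv_eq_of_mul_eq_one_right]
      rw [← pow_succ', Nat.sub_add_cancel (Nat.pos_of_ne_zero hn), hζ.pow_eq_one]
    rw [h2]
    ring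
  simp only [h1]
  rw [hζ.sum_pow_mul]
  congr 1
  rw [eq_iff_iff, ← (Nat.modEq_zero_iff_dvd)]
  have h3 : x + (n - 1) * y + y = x + n * y := by
    obtain ⟨n, rfl⟩ := Nat.exists_eq_succ_of_ne_zero hn
    simp only [Nat.succ_eq_add_one, Nat.add_sub_cancel]
    ring
  constructor
  · intro h
    have h4 := h.add_right y
    rw [h3, zero_add] at h4
    exact h4.symm.trans (by simp [Nat.ModEq])
  · intro h
    refine Nat.ModEq.add_right_cancel' y ?_
    rw [h3, zero_add]
    exact (show x + n * y ≡ x [MOD n] by simp [Nat.ModEq]).trans h.symm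

theorem sum_range_add_of_periodic {M : ℕ} {f : ℕ → ℂ} (hf : ∀ n, f (n + M) = f n) (a : ℕ) :
    ∑ n ∈ Finset.range M, f (a + n) = ∑ n ∈ Finset.range M, f n := by
  induction a with
  | zero => simp
  | succ a ih =>
    rw [← ih]
    have h1 := Finset.sum_range_succ (fun n => f (a + n)) M
    have h2 := Finset.sum_range_succ' (fun n => f (a + n)) M
    have h3 : ∀ n, f (a + 1 + n) = f (a + (n + 1)) := fun n => by congr 1; omega
    simp only [h3]
    rw [hf] at h1
    rw [add_zero] at h2
    exact add_right_cancel (h2.symm.trans h1)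

theorem sum_range_mul_eq {k r : ℕ} (hk : k ≠ 0) (f : ℕ → ℂ) :
    ∑ j ∈ Finset.range (k * r), f j =
      ∑ j ∈ Finset.range k, ∑ s ∈ Finset.range r, f (j + k * s) := by
  rw [← Finset.sum_product']
  have hk' := Nat.pos_of_ne_zero hk
  refine Finset.sum_bij' (fun j _ => (j % k, j / k)) (fun x _ => x.1 + k * x.2) ?_ ?_ ?_ ?_ ?_
  · intro j hj
    rw [Finset.mem_product, Finset.mem_range, Finset.mem_range]
    exact ⟨Nat.mod_lt _ hk', Nat.div_lt_of_lt_mul (Finset.mem_range.mp hj)⟩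
  · rintro ⟨i, s⟩ hx
    rw [Finset.mem_product, Finset.mem_range, Finset.mem_range] at hx
    rw [Finset.mem_range]
    calc i + k * s < k + k * s := by have := hx.1; omega
      _ = k * (s + 1) := by ring
      _ ≤ k * r := Nat.mul_le_mul_left _ hx.2
  · intro j _
    exact Nat.mod_add_div j k
  · rintro ⟨i, s⟩ hx
    rw [Finset.mem_product, Finset.mem_range] at hx
    simp only [Nat.add_mul_mod_self_left, Nat.mod_eq_of_lt hx.1, Nat.add_mul_div_left _ _ hk',
      Nat.div_eq_of_lt hx.1, zero_add]
  · intro j _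
    simp only [Nat.mod_add_div]

variable (p : ℕ) [Fact p.Prime] {F : Type*} [Field F] [Fintype F] [Algebra (ZMod p) F]
variable {γ : Fˣ} (hγ : Subgroup.zpowers γ = ⊤)

omit [Fintype F] in
theorem ne_zero_of_mem_cycClass {k i : ℕ} {x : F} (hx : x ∈ cycClass k γ i) : x ≠ 0 := by
  obtain ⟨y, -, rfl⟩ := hx
  exact Units.ne_zero _

include hγ

theorem pow_mem_cycClass_iff {k i n : ℕ} (hk : k ∣ Fintype.card F - 1) :
    (γ : F) ^ n ∈ cycClass k γ i ↔ n ≡ i [MOD k] := by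
  constructor
  · rintro ⟨y, hy, h⟩
    obtain ⟨l, rfl⟩ := mem_powers_iff_mem_zpowers.mpr hy
    have h1 : (γ : F) ^ n = (γ : F) ^ (i + k * l) := by
      rw [h]
      push_cast
      ring
    rw [pow_eq_pow_iff_of_zpowers_eq_top hγ] at h1
    exact (h1.of_dvd hk).trans (by simp [Nat.ModEq])
  · intro h
    obtain ⟨l, hl⟩ := (Nat.modEq_iff_dvd.mp h.symm)
    refine ⟨(γ ^ k) ^ l, ⟨l, rfl⟩, ?_⟩
    rw [← zpow_natCast γ k, ← zpow_mul, ← hl, ← zpow_natCast γ i, ← zpow_add]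
    simp

omit hγ in
theorem sum_inv_pow_mul_canonicalChar {z : ℂ} (hz : z ^ (Fintype.card F - 1) = 1) (a : ℕ) :
    ∑ n ∈ Finset.range (Fintype.card F - 1),
      z⁻¹ ^ n * canonicalChar p ((γ : F) ^ a * (γ : F) ^ n) = z ^ a * gammaSum p γ z⁻¹ := by
  have hz0 : z ≠ 0 := by
    rintro rfl
    rw [zero_pow (by have := Fintype.one_lt_card (α := F); omega)] at hz
    exact zero_ne_one hz
  have hγ1 : (γ : F) ^ (Fintype.card F - 1) = 1 := FiniteField.pow_card_sub_one_eq_one _ γ.ne_zero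
  rw [gammaSum, ← sum_range_add_of_periodic (a := a)
    (f := fun n => z⁻¹ ^ n * canonicalChar p ((γ : F) ^ n)), Finset.mul_sum]
  · refine Finset.sum_congr rfl fun n _ => ?_
    rw [← pow_add, pow_add z⁻¹, ← mul_assoc, ← mul_assoc, ← mul_pow, mul_inv_cancel₀ hz0, one_pow,
      one_mul]
  · intro n
    rw [pow_add, pow_add, hγ1, inv_pow z (Fintype.card F - 1), hz, inv_one, mul_one, mul_one]

/-- Orthogonality of the characters of order dividing k turns the indicator of each class into a
character sum. The condition `hinj` makes the classes disjoint, so that indicators add. -/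
theorem psiSum_iUnion_cycClass {T : Type*} (A : Finset T) (idx : T → ℕ) {k : ℕ}
    (hk : k ∣ Fintype.card F - 1)
    (hinj : ∀ s ∈ A, ∀ t ∈ A, idx s ≡ idx t [MOD k] → s = t) {g : ℂ} (hg : IsPrimitiveRoot g k)
    (a : ℕ) :
    psiSum p ((γ : F) ^ a) (⋃ t ∈ A, cycClass k γ (idx t)) =
      (∑ j ∈ Finset.range k, g ^ (j * a) * gammaSum p γ (g⁻¹ ^ j) * ∑ t ∈ A, g ^ (j * idx t)) /
        k := by
  classical
  have hq : 0 < Fintype.card F - 1 := by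
    have := Fintype.one_lt_card (α := F)
    omega
  have hk0 : k ≠ 0 := fun h => by rw [h, Nat.zero_dvd] at hk; omega
  have hkC : (k : ℂ) ≠ 0 := Nat.cast_ne_zero.mpr hk0
  rw [eq_div_iff hkC]
  have h1 : psiSum p ((γ : F) ^ a) (⋃ t ∈ A, cycClass k γ (idx t)) =
      ∑ n ∈ Finset.range (Fintype.card F - 1), ∑ t ∈ A,
        (if n ≡ idx t [MOD k] then 1 else 0) * canonicalChar p ((γ : F) ^ a * (γ : F) ^ n) := by
    have h2 : psiSum p ((γ : F) ^ a) (⋃ t ∈ A, cycClass k γ (idx t)) = ∑ x : F with x ≠ 0,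
        if x ∈ ⋃ t ∈ A, cycClass k γ (idx t) then canonicalChar p ((γ : F) ^ a * x) else 0 := by
      rw [psiSum, ← Finset.sum_filter, Finset.filter_filter]
      refine Finset.sum_congr ?_ fun _ _ => rfl
      ext x
      simp only [Finset.mem_filter, Finset.mem_univ, true_and, Set.mem_iUnion]
      constructor
      · rintro ⟨t, ht, hx⟩
        exact ⟨ne_zero_of_mem_cycClass hx, t, ht, hx⟩
      · exact fun h => h.2
    rw [h2, sum_ne_zero_eq_sum_range hγ]
    refine Finset.sum_congr rfl fun n _ => ?_
    rw [← Finset.sum_mul]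
    have h3 : (γ : F) ^ n ∈ ⋃ t ∈ A, cycClass k γ (idx t) ↔ ∃ t ∈ A, n ≡ idx t [MOD k] := by
      simp only [Set.mem_iUnion, pow_mem_cycClass_iff hγ hk, exists_prop]
    split_ifs with h4
    · obtain ⟨t, ht, h5⟩ := h3.mp h4
      rw [Finset.sum_eq_single_of_mem t ht fun s hs hst =>
        if_neg fun h6 => hst (hinj s hs t ht (h6.symm.trans h5)), if_pos h5, one_mul]
    · rw [Finset.sum_eq_zero fun t ht => if_neg fun h5 => h4 (h3.mpr ⟨t, ht, h5⟩), zero_mul]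
  have hgq : ∀ j, (g ^ j) ^ (Fintype.card F - 1) = 1 := fun j => by
    rw [← pow_mul, mul_comm, pow_mul, (hg.pow_eq_one_iff_dvd _).mpr hk, one_pow]
  have h4 : ∀ n t, (if n ≡ idx t [MOD k] then (1 : ℂ) else 0) * k =
      ∑ j ∈ Finset.range k, g ^ (j * idx t) * (g⁻¹ ^ j) ^ n := fun n t => by
    rw [hg.sum_pow_mul_inv_pow hk0]
    split_ifs <;> simp
  calc _ = ∑ n ∈ Finset.range (Fintype.card F - 1), ∑ t ∈ A, ∑ j ∈ Finset.range k,
        g ^ (j * idx t) * ((g ^ j)⁻¹ ^ n * canonicalChar p ((γ : F) ^ a * (γ : F) ^ n)) := by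
        rw [h1, Finset.sum_mul]
        refine Finset.sum_congr rfl fun n _ => ?_
        rw [Finset.sum_mul]
        refine Finset.sum_congr rfl fun t _ => ?_
        rw [mul_right_comm, h4, Finset.sum_mul]
        exact Finset.sum_congr rfl fun j _ => by rw [inv_pow g, mul_assoc]
    _ = ∑ j ∈ Finset.range k, ∑ t ∈ A, ∑ n ∈ Finset.range (Fintype.card F - 1),
        g ^ (j * idx t) * ((g ^ j)⁻¹ ^ n * canonicalChar p ((γ : F) ^ a * (γ : F) ^ n)) := by
        rw [Finset.sum_comm' (t' := A) (s' := fun _ => Finset.range (Fintype.card F - 1))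
          (by simp [and_comm])]
        rw [Finset.sum_congr rfl fun t _ => Finset.sum_comm, Finset.sum_comm]
    _ = _ := by
        refine Finset.sum_congr rfl fun j _ => ?_
        rw [Finset.mul_sum]
        refine Finset.sum_congr rfl fun t _ => ?_
        rw [← Finset.mul_sum, sum_inv_pow_mul_canonicalChar p (hgq j), ← pow_mul, inv_pow]
        ring

end Periods

/-! ### The pointwise identity between the two families of character sums. -/

section Lift

variable (p : ℕ) [Fact p.Prime] {F : Type*} [Field F] [Fintype F] [Algebra (ZMod p) F]
  {F' : Type*} [Field F'] [Fintype F'] [Algebra (ZMod p) F']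
  {γ : Fˣ} (hγ : Subgroup.zpowers γ = ⊤) {ω : F'ˣ} (hω : Subgroup.zpowers ω = ⊤)
  {k r m N : ℕ} (hr : r.Prime) (hrN : r.Coprime N) (hk : k = r ^ m * N)
  {g w : ℂ} (hg : IsPrimitiveRoot g k) (hw : IsPrimitiveRoot w (k * r)) (hwg : w ^ r = g)

include hrN in
theorem Nat.Coprime.dvd_add_mul_unique {a u v : ℕ} (hu : u < r) (hv : v < r)
    (h1 : r ∣ a + u * N) (h2 : r ∣ a + v * N) : u = v := by
  have h3 : u * N ≡ v * N [MOD r] := by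
    refine Nat.ModEq.add_left_cancel' a ?_
    exact ((Nat.modEq_zero_iff_dvd).mpr h1).trans ((Nat.modEq_zero_iff_dvd).mpr h2).symm
  exact (Nat.ModEq.cancel_right_of_coprime hrN h3).eq_of_lt_of_lt hu hv

include hr hrN hw hwg in
/-- Multiplying by the discrete Fourier transform of the shifts `u N`, `u < r`, turns the Fourier
sum modulo `k r` of a function of period `k` into its Fourier sum modulo `k`. -/
theorem sum_range_mul_fourier (hk0 : k ≠ 0) {f : ℕ → ℂ} (hf : ∀ j s, f (j + k * s) = f j)
    {a b u : ℕ} (hu : u < r) (hab : a + u * N = r * b) :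
    ∑ j ∈ Finset.range (k * r), w ^ (j * a) * f j *
      ∑ v ∈ Finset.range r, w ^ (j * (v * N)) = r * ∑ j ∈ Finset.range k, g ^ (j * b) * f j := by
  have hwk : IsPrimitiveRoot (w ^ k) r := hw.pow (Nat.pos_of_ne_zero
    (mul_ne_zero hk0 hr.ne_zero)) rfl
  rw [sum_range_mul_eq hk0, Finset.mul_sum]
  refine Finset.sum_congr rfl fun j _ => ?_
  -- On the coset j + k s only the phases depend on s. Summing over s leaves the v with r ∣ a + vN,
  -- and v = u is the only one; there w^(rb) = g^b.
  calc _ = ∑ s ∈ Finset.range r, ∑ v ∈ Finset.range r,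
        f j * w ^ (j * (a + v * N)) * ((w ^ k) ^ (a + v * N)) ^ s := by
        refine Finset.sum_congr rfl fun s _ => ?_
        rw [Finset.mul_sum]
        refine Finset.sum_congr rfl fun v _ => ?_
        rw [hf]
        ring
    _ = ∑ v ∈ Finset.range r, f j * w ^ (j * (a + v * N)) *
        if r ∣ a + v * N then (r : ℂ) else 0 := by
        rw [Finset.sum_comm]
        refine Finset.sum_congr rfl fun v _ => ?_
        rw [← Finset.mul_sum, hwk.sum_pow_mul]
    _ = _ := by
        rw [Finset.sum_eq_single_of_mem u (Finset.mem_range.mpr hu), if_pos ⟨b, hab⟩, hab,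
          ← hwg]
        · ring
        · intro v hv hvu
          rw [if_neg, mul_zero]
          intro h
          exact hvu (hrN.dvd_add_mul_unique (Finset.mem_range.mp hv) hu h ⟨b, hab⟩)

include hγ hω hr hrN hk hg hw hwg in
theorem psiSum_lift (hkF : k ∣ Fintype.card F - 1) (hkF' : k * r ∣ Fintype.card F' - 1)
    {I : Finset ℕ} (hI : I ⊆ Finset.range k) {c : ℂ}
    (hA : ∀ j, ¬ r ^ m ∣ j → ∑ i ∈ I, g ^ (j * i) = 0 ∨
      gammaSum p ω (w⁻¹ ^ j) = c * gammaSum p γ (g⁻¹ ^ j))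
    (hB : ∀ v, ¬ N ∣ v → gammaSum p ω (w⁻¹ ^ (r ^ (m + 1) * v)) =
      c * gammaSum p γ (g⁻¹ ^ (r ^ (m + 1) * v)))
    {a b u : ℕ} (hu : u < r) (hab : a + u * N = r * b) :
    psiSum p ((ω : F') ^ a) (⋃ i ∈ I, ⋃ j ∈ Finset.range r, cycClass (k * r) ω (i * r + j * N)) =
      c * psiSum p ((γ : F) ^ b) (⋃ i ∈ I, cycClass k γ i) + (I.card : ℂ) * (c - 1) / k := by
  have hk0 : k ≠ 0 := fun h => by
    have := Fintype.one_lt_card (α := F)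
    rw [h, Nat.zero_dvd] at hkF
    omega
  have hkC : (k : ℂ) ≠ 0 := Nat.cast_ne_zero.mpr hk0
  have hrC : (r : ℂ) ≠ 0 := Nat.cast_ne_zero.mpr hr.ne_zero
  have hset : (⋃ i ∈ I, ⋃ j ∈ Finset.range r, cycClass (k * r) ω (i * r + j * N)) =
      ⋃ t ∈ I ×ˢ Finset.range r, cycClass (k * r) ω (t.1 * r + t.2 * N) := by
    ext x
    simp only [Set.mem_iUnion, Finset.mem_product, exists_prop, Prod.exists]
    constructor
    · rintro ⟨i, hi, j, hj, hx⟩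
      exact ⟨i, j, ⟨hi, hj⟩, hx⟩
    · rintro ⟨i, j, ⟨hi, hj⟩, hx⟩
      exact ⟨i, hi, j, hj, hx⟩
  have hinj : ∀ s ∈ I ×ˢ Finset.range r, ∀ t ∈ I ×ˢ Finset.range r,
      s.1 * r + s.2 * N ≡ t.1 * r + t.2 * N [MOD (k * r)] → s = t := by
    -- Modulo r the index determines x, because N is invertible; cancelling r then determines i
    -- modulo k.
    rintro ⟨i, x⟩ hs ⟨j, y⟩ ht h
    rw [Finset.mem_product, Finset.mem_range] at hs ht
    have h1 : x = y := by
      have h2 := h.of_dvd (dvd_mul_left r k)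
      have h3 : x * N ≡ y * N [MOD r] := by
        have h4 : ∀ i x : ℕ, i * r + x * N ≡ x * N [MOD r] := fun i x => by
          simp [Nat.ModEq]
        exact (h4 i x).symm.trans (h2.trans (h4 j y))
      exact (Nat.ModEq.cancel_right_of_coprime hrN h3).eq_of_lt_of_lt hs.2 ht.2
    subst h1
    have h2 : i ≡ j [MOD k] := Nat.ModEq.mul_right_cancel' hr.ne_zero
      (Nat.ModEq.add_right_cancel' _ h)
    rw [h2.eq_of_lt_of_lt (Finset.mem_range.mp (hI hs.1)) (Finset.mem_range.mp (hI ht.1))]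
  rw [hset, psiSum_iUnion_cycClass p hω _ _ hkF' hinj hw,
    psiSum_iUnion_cycClass p hγ I (fun i => i) hkF (fun s hs t ht h =>
      h.eq_of_lt_of_lt (Finset.mem_range.mp (hI hs)) (Finset.mem_range.mp (hI ht))) hg]
  have hS : ∀ j, ∑ t ∈ I ×ˢ Finset.range r, w ^ (j * (t.1 * r + t.2 * N)) =
      (∑ i ∈ I, g ^ (j * i)) * ∑ v ∈ Finset.range r, w ^ (j * (v * N)) := fun j => by
    rw [Finset.sum_mul_sum, ← Finset.sum_product']
    refine Finset.sum_congr rfl fun t _ => ?_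
    rw [← hwg]
    ring
  have hwk : IsPrimitiveRoot (w ^ k) r := hw.pow (Nat.pos_of_ne_zero
    (mul_ne_zero hk0 hr.ne_zero)) rfl
  -- Each Gauss sum over F' becomes c times the one over F. At j = 0 both equal -1, so the
  -- replacement must be corrected by (c - 1)|I| r.
  have key : ∀ j ∈ Finset.range (k * r), w ^ (j * a) * gammaSum p ω (w⁻¹ ^ j) *
      ∑ t ∈ I ×ˢ Finset.range r, w ^ (j * (t.1 * r + t.2 * N)) =
      c * (w ^ (j * a) * (gammaSum p γ (g⁻¹ ^ j) * ∑ i ∈ I, g ^ (j * i)) *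
        ∑ v ∈ Finset.range r, w ^ (j * (v * N))) +
      if j = 0 then (c - 1) * I.card * r else 0 := by
    intro j hj
    rw [hS]
    by_cases hj0 : j = 0
    · subst hj0
      simp only [zero_mul, pow_zero, gammaSum_one p hγ, gammaSum_one p hω, Finset.sum_const,
        Finset.card_range, nsmul_eq_mul, if_true]
      ring
    rw [if_neg hj0, add_zero]
    by_cases h1 : r ^ m ∣ j
    · obtain ⟨v, rfl⟩ := h1
      by_cases h2 : r ∣ v
      · obtain ⟨v, rfl⟩ := h2
        -- Here 0 < j < kr = r^(m+1) N.
        have h3 : ¬ N ∣ v := by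
          rintro ⟨x, rfl⟩
          refine hj0 (Nat.eq_zero_of_dvd_of_lt ⟨x, ?_⟩ (Finset.mem_range.mp hj))
          rw [hk]
          ring
        have h4 := hB v h3
        rw [pow_succ, mul_assoc] at h4
        rw [h4]
        ring
      -- Since r^m N = k, this is a sum over all powers of the nontrivial r-th root of unity w^(kv).
      · have h3 : ∑ x ∈ Finset.range r, w ^ (r ^ m * v * (x * N)) = 0 := by
          have h4 := hwk.sum_pow_mul v
          rw [if_neg h2] at h4
          rw [← h4]
          refine Finset.sum_congr rfl fun x _ => ?_
          rw [← pow_mul, ← pow_mul, hk]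
          congr 1
          ring
        rw [h3]
        ring
    · rcases hA j h1 with h | h <;> rw [h] <;> ring
  rw [Finset.sum_congr rfl key, Finset.sum_add_distrib, ← Finset.mul_sum,
    sum_range_mul_fourier hr hrN hw hwg hk0 _ hu hab, Finset.sum_ite_eq' _ 0,
    if_pos (Finset.mem_range.mpr (Nat.pos_of_ne_zero (mul_ne_zero hk0 hr.ne_zero)))]
  · simp only [← mul_assoc]
    push_cast
    field_simp
  · intro j s
    have hgk : g ^ k = 1 := hg.pow_eq_one
    rw [pow_add g⁻¹, pow_mul g⁻¹, inv_pow g k, hgk, inv_one, one_pow, mul_one]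
    congr 1
    refine Finset.sum_congr rfl fun i _ => ?_
    rw [add_mul, pow_add, mul_assoc, pow_mul g k, hgk, one_pow, mul_one]

end Lift

/-! ### From the hypotheses at divisors of k to all frequencies. -/

section Hypotheses

variable (p : ℕ) [Fact p.Prime] {F : Type*} [Field F] [Fintype F] [Algebra (ZMod p) F]
  {F' : Type*} [Field F'] [Fintype F'] [Algebra (ZMod p) F']
  {γ : Fˣ} (hγ : Subgroup.zpowers γ = ⊤) {ω : F'ˣ} (hω : Subgroup.zpowers ω = ⊤)

theorem psiValues_eq_range (γ : Fˣ) (D : Set F) :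
    psiValues p γ D = Set.range fun a : ℕ => psiSum p ((γ : F) ^ a) D := by
  have hq : 1 < Fintype.card F := Fintype.one_lt_card
  have hγ1 : (γ : F) ^ (Fintype.card F - 1) = 1 := FiniteField.pow_card_sub_one_eq_one _ γ.ne_zero
  ext z
  constructor
  · rintro ⟨a, -, rfl⟩
    exact ⟨a, rfl⟩
  · rintro ⟨a, rfl⟩
    refine ⟨a % (Fintype.card F - 1), ?_, ?_⟩
    · have := Nat.mod_lt a (show 0 < Fintype.card F - 1 by omega)
      omega
    · simp only [← pow_eq_pow_mod a hγ1]

variable {k r m N : ℕ} (hr : r.Prime) (hrN : r.Coprime N) (hk : k = r ^ m * N)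
  {g w : ℂ} (hg : IsPrimitiveRoot g k) (hw : IsPrimitiveRoot w (k * r)) (hwg : w ^ r = g)

include hr hrN hk in
theorem gcd_mul_prime_dvd {j : ℕ} (hj : ¬ r ^ m ∣ j) : j.gcd (k * r) ∣ k := by
  have h1 : k * r = r ^ (m + 1) * N := by rw [hk]; ring
  rw [h1, (Nat.Coprime.pow_left (m + 1) hrN).gcd_mul, hk]
  refine mul_dvd_mul ?_ (Nat.gcd_dvd_right _ _)
  obtain ⟨i, -, hi⟩ := (Nat.dvd_prime_pow hr).mp (Nat.gcd_dvd_right j (r ^ (m + 1)))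
  rw [hi]
  refine pow_dvd_pow r ?_
  by_contra! h
  exact hj ((pow_dvd_pow r h.le).trans (hi ▸ Nat.gcd_dvd_left _ _))

include hg in
-- Condition (i) concerns ζ_k and divisors of k. Equal gcds with k make g^j and ζ^d Galois
-- conjugate, and a vanishing sum stays zero under conjugation.
theorem sum_pow_mul_eq_zero_of_gcd_eq (hk0 : k ≠ 0) {ζ : ℂ} (hζ : IsPrimitiveRoot ζ k)
    {d j : ℕ} (hd : d.gcd k = j.gcd k) {I : Finset ℕ} (h : ∑ i ∈ I, ζ ^ (i * d) = 0) :
    ∑ i ∈ I, g ^ (j * i) = 0 := by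
  have : NeZero k := ⟨hk0⟩
  obtain ⟨x, -, hx, rfl⟩ := (hζ.isPrimitiveRoot_iff).mp hg
  obtain ⟨u, hu, hdu⟩ := exists_coprime_mul_modEq (x := d) (y := x * j) hk0
    (by rw [hx.gcd_mul_left_cancel, hd])
  obtain ⟨τ, hτ⟩ := exists_ringEquiv_pow_of_coprime hk0 hu
  have h1 := congrArg τ h
  rw [map_sum, map_zero] at h1
  rw [← h1]
  refine Finset.sum_congr rfl fun i _ => ?_
  rw [map_pow, hτ ζ hζ.pow_eq_one, ← pow_mul, ← pow_mul]
  refine pow_eq_pow_of_modEq ?_ hζ.pow_eq_one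
  have h2 := (hdu.mul_left i).symm
  convert h2 using 1 <;> ring

include hw hwg in
-- Conjugate by an automorphism that fixes ζ_p and sends w^d to w^(-j); by w^r = g it sends g^d to
-- g^(-j). The factor c is an integer, hence fixed.
theorem gammaSum_eq_of_gcd_eq (hkF' : k * r ∣ Fintype.card F' - 1) (hkr : k * r ≠ 0) {c : ℤ}
    {d j : ℕ} (hd : d.gcd (k * r) = j.gcd (k * r))
    (h : gammaSum p ω (w ^ d) = c * gammaSum p γ (g ^ d)) :
    gammaSum p ω (w⁻¹ ^ j) = c * gammaSum p γ (g⁻¹ ^ j) := by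
  have hp : p.Prime := Fact.out
  have hw1 : w ^ (k * r) = 1 := hw.pow_eq_one
  have hcop : (k * r).Coprime (k * r - 1) := by
    refine (Nat.coprime_self_sub_right (Nat.pos_of_ne_zero hkr)).mpr (Nat.coprime_one_right _)
  -- The multiplier kr - 1 stands for -1 modulo kr.
  obtain ⟨u, hu, hdu⟩ := exists_coprime_mul_modEq (x := d) (y := (k * r - 1) * j) hkr
    (by rw [hcop.symm.gcd_mul_left_cancel, hd])
  have hkp : (k * r).Coprime p := coprime_of_dvd_card_sub_one p hkF'
  obtain ⟨v, hv1, hv2⟩ := Nat.chineseRemainder hkp u 1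
  have hv : v.Coprime (k * r * p) := by
    refine Nat.Coprime.mul_right ?_ ?_
    · rwa [Nat.Coprime, hv1.gcd_eq]
    · rw [Nat.Coprime, hv2.gcd_eq, Nat.gcd_one_left]
  obtain ⟨τ, hτ⟩ := exists_ringEquiv_pow_of_coprime (mul_ne_zero hkr hp.ne_zero) hv
  have hτp : ∀ z : ℂ, z ^ p = 1 → τ z = z := fun z hz => by
    rw [hτ z (by rw [mul_comm, pow_mul, hz, one_pow]), pow_eq_pow_of_modEq hv2 hz, pow_one]
  have hτw : τ (w ^ d) = w⁻¹ ^ j := by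
    have h1 : w⁻¹ = w ^ (k * r - 1) := by
      rw [inv_eq_of_mul_eq_one_right]
      rw [← pow_succ', Nat.sub_add_cancel (Nat.pos_of_ne_zero hkr), hw1]
    rw [map_pow, hτ w (by rw [pow_mul, hw1, one_pow]), ← pow_mul, h1, ← pow_mul]
    refine pow_eq_pow_of_modEq ?_ hw1
    rw [mul_comm v d]
    exact (hv1.mul_left d).trans hdu
  have hτg : τ (g ^ d) = g⁻¹ ^ j := by
    rw [← hwg, ← pow_mul, mul_comm, pow_mul, map_pow, hτw]
    ring
  have h1 := congrArg τ h
  rwa [map_gammaSum p hτp, map_mul, map_gammaSum p hτp, map_intCast, hτw, hτg] at h1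

include hγ hr hrN hk hg hwg in
-- With η = g^(-r^m), of order N, w^(-r^(m+1) x) is η^x. So `h` and `hlift` give G(z)^r = c G(z),
-- and cancelling G(z) ≠ 0 gives the constant (r-1)-st power that makes G(z^r) = G(z).
theorem gammaSum_eq_of_not_dvd (hkF : k ∣ Fintype.card F - 1) {c : ℂ}
    (hc : c ^ 2 = (Fintype.card F : ℂ) ^ (r - 1))
    (hlift : ∀ z : ℂ, z ^ k = 1 → gammaSum p ω z = gammaSum p γ z ^ r)
    (h : ∀ v, 1 ≤ v → v ≤ N - 1 → gammaSum p ω (w⁻¹ ^ (r ^ (m + 1) * v)) =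
      c * gammaSum p γ (g⁻¹ ^ (r ^ m * v))) {v : ℕ} (hv : ¬ N ∣ v) :
    gammaSum p ω (w⁻¹ ^ (r ^ (m + 1) * v)) = c * gammaSum p γ (g⁻¹ ^ (r ^ (m + 1) * v)) := by
  have hq : 1 < Fintype.card F := Fintype.one_lt_card
  have hk0 : k ≠ 0 := fun h => by
    rw [h, Nat.zero_dvd] at hkF
    omega
  have hN0 : N ≠ 0 := fun h => hk0 (by rw [hk, h, mul_zero])
  have hNk : N ∣ k := ⟨r ^ m, by rw [hk, mul_comm]⟩
  have hη : IsPrimitiveRoot (g⁻¹ ^ r ^ m) N := hg.inv.pow (Nat.pos_of_ne_zero hk0) hk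
  have hwη : ∀ x, w⁻¹ ^ (r ^ (m + 1) * x) = (g⁻¹ ^ r ^ m) ^ x := fun x => by
    rw [← hwg]
    ring
  have hNone : ∀ {z : ℂ}, z ^ N = 1 → z ^ k = 1 := fun hz => by
    obtain ⟨l, hl⟩ := hNk
    rw [hl, pow_mul, hz, one_pow]
  have hpow : ∀ z : ℂ, z ^ N = 1 → z ≠ 1 → gammaSum p γ z ^ r = c * gammaSum p γ z := by
    intro z hz hz1
    have : NeZero N := ⟨hN0⟩
    obtain ⟨x, hx, rfl⟩ := hη.eq_pow_of_pow_eq_one hz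
    have hx0 : 1 ≤ x := Nat.one_le_iff_ne_zero.mpr fun h0 => hz1 (by rw [h0, pow_zero])
    have h1 := h x hx0 (by omega)
    rwa [hwη, pow_mul g⁻¹, hlift _ (hNone hz)] at h1
  have hpow' : ∀ z : ℂ, z ^ N = 1 → z ≠ 1 → gammaSum p γ z ^ (r - 1) = c := by
    intro z hz hz1
    obtain ⟨l, hl⟩ := hkF
    have h0 : gammaSum p γ z ≠ 0 :=
      gammaSum_ne_zero p hγ (by rw [hl, pow_mul, hNone hz, one_pow]) hz1
    refine mul_right_cancel₀ h0 ?_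
    rw [← pow_succ, Nat.sub_add_cancel hr.one_le, hpow z hz hz1]
  set z := (g⁻¹ ^ r ^ m) ^ v with hz_def
  have hz : z ^ N = 1 := by rw [hz_def, ← pow_mul, mul_comm, pow_mul, hη.pow_eq_one, one_pow]
  have hz1 : z ≠ 1 := fun h1 => hv ((hη.pow_eq_one_iff_dvd v).mp h1)
  have h1 : g⁻¹ ^ (r ^ (m + 1) * v) = z ^ r := by
    rw [hz_def]
    ring
  rw [h1, gammaSum_pow_eq p hγ hr.two_le hrN (hNk.trans hkF) hc hpow' hz, hwη,
    hlift _ (hNone hz), hpow z hz hz1]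

end Hypotheses

/-! ### Indices and totients. -/

section PowIndex

theorem powIndex_dvd_totient (p d : ℕ) (hd : d ≠ 0) : powIndex p d ∣ Nat.totient d := by
  have : NeZero d := ⟨hd⟩
  rw [← ZMod.card_units_eq_totient, ← Nat.card_eq_fintype_card]
  exact Subgroup.index_dvd_card _

theorem powIndex_ne_zero (p d : ℕ) (hd : d ≠ 0) : powIndex p d ≠ 0 := fun h =>
  have h1 := powIndex_dvd_totient p d hd
  (Nat.totient_pos.mpr (Nat.pos_of_ne_zero hd)).ne' (Nat.eq_zero_of_zero_dvd (h ▸ h1))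

theorem totient_mul_prime_of_dvd {k r : ℕ} (hr : r.Prime) (h : r ∣ k) :
    Nat.totient (k * r) = r * Nat.totient k := by
  rw [mul_comm, Nat.totient_mul_of_prime_of_dvd hr h]

end PowIndex

/-! ### The Teichmüller character as a character of exact order k. -/

section Teichmuller

variable (k p : ℕ) [NeZero k] [Fact p.Prime] (hpk : p.Coprime k)
  (P : Ideal (𝓞 (cycField k))) (hP : P.IsPrime) (hpP : (p : 𝓞 (cycField k)) ∈ P)

include hpk hP hpP

theorem isTeichmullerValue_teichmuller {α : 𝓞 (cycField k) ⧸ P} (hα : α ≠ 0) :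
    IsTeichmullerValue k P α (teichmuller k P α) := by
  rw [teichmuller, if_neg hα]
  exact Classical.epsilon_spec (existsUnique_isTeichmullerValue k p hpk P hP hpP α hα).exists

theorem teichmuller_eq_of_isTeichmullerValue {α : 𝓞 (cycField k) ⧸ P} (hα : α ≠ 0) {z : ℂ}
    (h : IsTeichmullerValue k P α z) : teichmuller k P α = z :=
  (existsUnique_isTeichmullerValue k p hpk P hP hpP α hα).unique
    (isTeichmullerValue_teichmuller k p hpk P hP hpP hα) h

theorem exists_isPrimitiveRoot_quotient_mk :
    P.IsMaximal ∧ Finite (𝓞 (cycField k) ⧸ P) ∧ ∃ z : 𝓞 (cycField k),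
      ((z : cycField k) : ℂ) = zetaC k ∧ IsPrimitiveRoot (Ideal.Quotient.mk P z) k := by
  have hζ : IsPrimitiveRoot (zetaC k) k := Complex.isPrimitiveRoot_exp k (NeZero.ne k)
  have hfin : FiniteDimensional ℚ (cycField k) :=
    IntermediateField.adjoin.finiteDimensional
      ((hζ.isIntegral (NeZero.pos k)).tower_top (A := ℚ))
  have : NumberField (cycField k) := { to_charZero := inferInstance, to_finiteDimensional := hfin }
  let ζK : cycField k := ⟨zetaC k, IntermediateField.mem_adjoin_simple_self ℚ (zetaC k)⟩
  have hζK : IsPrimitiveRoot ζK k :=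
    IsPrimitiveRoot.of_map_of_injective (f := (cycField k).val) hζ (cycField k).val.injective
  let z : 𝓞 (cycField k) := ⟨ζK, hζK.isIntegral (NeZero.pos k)⟩
  have hz : IsPrimitiveRoot z k :=
    IsPrimitiveRoot.of_map_of_injective (f := algebraMap (𝓞 (cycField k)) (cycField k)) hζK
      NumberField.RingOfIntegers.coe_injective
  have hPbot : P ≠ ⊥ := by
    rintro rfl
    exact (Nat.cast_ne_zero (R := 𝓞 (cycField k))).mpr (Fact.out : p.Prime).ne_zero
      (by simpa using hpP)
  have hmax : P.IsMaximal := Ring.DimensionLEOne.maximalOfPrime hPbot hP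
  let _ := Ideal.Quotient.field P
  have hfinite : Finite (𝓞 (cycField k) ⧸ P) := inferInstance
  have : Fintype (𝓞 (cycField k) ⧸ P) := Fintype.ofFinite _
  have hp0 : (p : 𝓞 (cycField k) ⧸ P) = 0 := by
    simpa using Ideal.Quotient.eq_zero_iff_mem.mpr hpP
  have : CharP (𝓞 (cycField k) ⧸ P) p := by
    rcases (Nat.dvd_prime (Fact.out : p.Prime)).mp (ringChar.dvd hp0) with h2 | h2
    · exact absurd h2 CharP.ringChar_ne_one
    · exact ringChar.of_eq h2
  obtain ⟨n, -, hcard⟩ := FiniteField.card (𝓞 (cycField k) ⧸ P) p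
  have habs : Ideal.absNorm P = p ^ (n : ℕ) := by
    rw [Ideal.absNorm_apply, Submodule.cardQuot_apply, Nat.card_eq_fintype_card]
    exact hcard
  exact ⟨hmax, hfinite, z, rfl, hz.idealQuotient_mk (by simpa using hmax.ne_top)
      (by rw [habs]; exact Nat.Coprime.pow_left _ hpk)⟩

variable {F : Type*} [Field F] [Fintype F] (ι : (𝓞 (cycField k) ⧸ P) ≃+* F)

omit [Fintype F] in
theorem teichmullerChar_pow {x : F} (hx : x ≠ 0) (n : ℕ) :
    teichmullerChar k P ι (x ^ n) = teichmullerChar k P ι x ^ n := by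
  have hx' : ι.symm x ≠ 0 := by simpa using hx
  obtain ⟨⟨i, hi⟩, z, hz, hzx⟩ := isTeichmullerValue_teichmuller k p hpk P hP hpP hx'
  rw [teichmullerChar, teichmullerChar, map_pow]
  refine teichmuller_eq_of_isTeichmullerValue k p hpk P hP hpP ?_
    ⟨⟨i * n, by rw [hi, pow_mul]⟩, z ^ n, ?_, ?_⟩
  · rw [← map_pow]
    simpa using fun h : x = 0 => absurd h hx
  · rw [← hz]
    rfl
  · rw [map_pow, hzx, pow_right_comm]

omit [NeZero k] [Fact p.Prime] hpk hP hpP in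
include ι in
theorem natCard_quotient_eq : Nat.card (𝓞 (cycField k) ⧸ P) = Fintype.card F := by
  rw [Nat.card_congr ι.toEquiv, Nat.card_eq_fintype_card]

include ι in
theorem dvd_card_sub_one_of_residueField : k ∣ Fintype.card F - 1 := by
  obtain ⟨hmax, -, z, -, hzk⟩ := exists_isPrimitiveRoot_quotient_mk k p hpk P hP hpP
  have h1 := hzk.map_of_injective ι.injective
  exact h1.dvd_of_pow_eq_one _ (FiniteField.pow_card_sub_one_eq_one _ (h1.ne_zero (NeZero.ne k)))

/-- The residue γ^((q-1)/k) has order k, and reduction modulo P is injective on the powers of ζ_k.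
-/
theorem isPrimitiveRoot_teichmullerChar {γ : Fˣ} (hγ : Subgroup.zpowers γ = ⊤) :
    IsPrimitiveRoot (teichmullerChar k P ι (γ : F)) k := by
  have hζ : IsPrimitiveRoot (zetaC k) k := Complex.isPrimitiveRoot_exp k (NeZero.ne k)
  have hdvd := dvd_card_sub_one_of_residueField k p hpk P hP hpP ι
  obtain ⟨hmax, -, z, hz, hzk⟩ := exists_isPrimitiveRoot_quotient_mk k p hpk P hP hpP
  have hq : 0 < Fintype.card F - 1 := by
    have := Fintype.one_lt_card (α := F)
    omega
  have hγ0 : ι.symm (γ : F) ≠ 0 := by simp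
  obtain ⟨⟨i, hi⟩, y, hy, hyx⟩ := isTeichmullerValue_teichmuller k p hpk P hP hpP hγ0
  have hγ' : IsPrimitiveRoot (γ : F) (Fintype.card F - 1) :=
    IsPrimitiveRoot.coe_units_iff.mpr
      (orderOf_eq_of_zpowers_eq_top hγ ▸ IsPrimitiveRoot.orderOf γ)
  have h1 : IsPrimitiveRoot (ι.symm (γ : F) ^ ((Fintype.card F - 1) / k)) k :=
    (hγ'.map_of_injective ι.symm.injective).pow hq (Nat.div_mul_cancel hdvd).symm
  have hyz : y = z ^ i := by
    apply NumberField.RingOfIntegers.coe_injective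
    apply Subtype.coe_injective
    refine hy.trans (hi.trans ?_)
    rw [← hz]
    rfl
  rw [natCard_quotient_eq k P ι, hyz, map_pow] at hyx
  rw [← hyx] at h1
  rw [teichmullerChar, hi]
  exact hζ.pow_of_coprime i ((hzk.pow_iff_coprime (NeZero.pos k) i).mp h1)

end Teichmuller

/-! ### Teichmüller characters and Gauss sums in the residue field extension. -/

section ResidueFieldLift

theorem zetaC_mul_pow (k r : ℕ) (hk : k ≠ 0) (hr : r ≠ 0) : zetaC (k * r) ^ r = zetaC k := by
  rw [zetaC, zetaC, ← Complex.exp_nat_mul]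
  congr 1
  have hk' : (k : ℂ) ≠ 0 := Nat.cast_ne_zero.mpr hk
  have hr' : (r : ℂ) ≠ 0 := Nat.cast_ne_zero.mpr hr
  push_cast
  field_simp

theorem cycField_le_cycField_mul (k r : ℕ) (hk : k ≠ 0) (hr : r ≠ 0) :
    cycField k ≤ cycField (k * r) := by
  rw [cycField, IntermediateField.adjoin_simple_le_iff, ← zetaC_mul_pow k r hk hr]
  exact pow_mem (IntermediateField.mem_adjoin_simple_self ℚ _) r

variable (k k' r p : ℕ) [NeZero k] [NeZero k'] [Fact p.Prime] (hr : r ≠ 0) (hk' : k' = k * r)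
  (hpk : p.Coprime k) (hpk' : p.Coprime k')
  (P : Ideal (𝓞 (cycField k))) (hP : P.IsPrime) (hpP : (p : 𝓞 (cycField k)) ∈ P)
  (P' : Ideal (𝓞 (cycField k'))) (hP' : P'.IsPrime) (hpP' : (p : 𝓞 (cycField k')) ∈ P')
  (hPP' : ∀ (x : 𝓞 (cycField k)) (y : 𝓞 (cycField k')),
      ((x : cycField k) : ℂ) = ((y : cycField k') : ℂ) → (x ∈ P ↔ y ∈ P'))

theorem exists_ringOfIntegers_ringHom {E E' : IntermediateField ℚ ℂ} (hle : E ≤ E') :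
    ∃ f : 𝓞 E →+* 𝓞 E', ∀ x : 𝓞 E, ((f x : E') : ℂ) = ((x : E) : ℂ) := by
  refine ⟨NumberField.RingOfIntegers.mapRingHom (IntermediateField.inclusion hle).toRingHom,
    fun x => ?_⟩
  rw [NumberField.RingOfIntegers.mapRingHom_apply]
  exact IntermediateField.coe_inclusion hle (x : E)

omit [NeZero k'] in
include hr hk' hPP' in
theorem exists_quotient_ringHom :
    ∃ φ : (𝓞 (cycField k) ⧸ P) →+* (𝓞 (cycField k') ⧸ P'),
      ∀ (x : 𝓞 (cycField k)) (y : 𝓞 (cycField k')),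
        ((x : cycField k) : ℂ) = ((y : cycField k') : ℂ) →
          φ (Ideal.Quotient.mk P x) = Ideal.Quotient.mk P' y := by
  have hle : cycField k ≤ cycField k' := by
    rw [hk']
    exact cycField_le_cycField_mul k r (NeZero.ne k) hr
  obtain ⟨f, hf⟩ := exists_ringOfIntegers_ringHom hle
  have hPf : P ≤ P'.comap f := fun x hx =>
    Ideal.mem_comap.mpr ((hPP' x (f x) (hf x).symm).mp hx)
  refine ⟨Ideal.quotientMap P' f hPf, fun x y hxy => ?_⟩
  rw [Ideal.quotientMap_mk]
  congr 1
  apply NumberField.RingOfIntegers.coe_injective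
  apply Subtype.coe_injective
  exact (hf x).trans hxy

variable {F : Type*} [Field F] [Fintype F] (ι : (𝓞 (cycField k) ⧸ P) ≃+* F)
  {F' : Type*} [Field F'] [Fintype F'] (ι' : (𝓞 (cycField k') ⧸ P') ≃+* F')

include hr hk' hpk hpk' hP hpP hP' hpP' in
-- The norm is the power with exponent (q'-1)/(q-1), and k' = kr gives (q'-1)/(q-1) · (q-1)/k = r
-- (q'-1)/k'.
theorem teichmullerChar_norm [Algebra F F'] {φ : (𝓞 (cycField k) ⧸ P) →+* (𝓞 (cycField k') ⧸ P')}
    (hφ : ∀ (x : 𝓞 (cycField k)) (y : 𝓞 (cycField k')),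
      ((x : cycField k) : ℂ) = ((y : cycField k') : ℂ) →
        φ (Ideal.Quotient.mk P x) = Ideal.Quotient.mk P' y)
    (halg : ∀ x : 𝓞 (cycField k) ⧸ P, algebraMap F F' (ι x) = ι' (φ x)) {x : F'} (hx : x ≠ 0) :
    teichmullerChar k P ι (Algebra.norm F x) = teichmullerChar k' P' ι' x ^ r := by
  have hx' : ι'.symm x ≠ 0 := by simpa using hx
  obtain ⟨hmax, -, z, hz, -⟩ := exists_isPrimitiveRoot_quotient_mk k p hpk P hP hpP
  obtain ⟨hmax', -, -⟩ := exists_isPrimitiveRoot_quotient_mk k' p hpk' P' hP' hpP'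
  obtain ⟨⟨i, hi⟩, y, hy, hyx⟩ := isTeichmullerValue_teichmuller k' p hpk' P' hP' hpP' hx'
  let _ := Ideal.Quotient.field P
  have hnorm : ι.symm (Algebra.norm F x) ≠ 0 := by
    have := Algebra.norm_ne_zero_iff (R := F) (x := x)
    simpa using hx
  have hval : teichmuller k' P' (ι'.symm x) ^ r = zetaC k ^ i := by
    rw [hi, pow_right_comm, hk', zetaC_mul_pow k r (NeZero.ne k) hr]
  have hzi : (((z ^ i : 𝓞 (cycField k)) : cycField k) : ℂ) = zetaC k ^ i := by
    rw [← hz]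
    rfl
  refine teichmuller_eq_of_isTeichmullerValue k p hpk P hP hpP hnorm
    ⟨⟨i, hval⟩, z ^ i, hzi.trans hval.symm, ?_⟩
  have hinj : Function.Injective φ := φ.injective
  apply hinj
  have hyr : (((y ^ r : 𝓞 (cycField k')) : cycField k') : ℂ) = zetaC k ^ i := by
    rw [← hval, ← hy]
    rfl
  rw [hφ (z ^ i) (y ^ r) (hzi.trans hyr.symm), map_pow, hyx, map_pow, natCard_quotient_eq k P ι,
    natCard_quotient_eq k' P' ι']
  have h1 : φ (ι.symm (Algebra.norm F x)) =
      ι'.symm x ^ ((Fintype.card F' - 1) / (Fintype.card F - 1)) := by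
    apply ι'.injective
    rw [← halg, RingEquiv.apply_symm_apply, map_pow, RingEquiv.apply_symm_apply,
      FiniteField.algebraMap_norm_eq_pow, Nat.card_eq_fintype_card, Nat.card_eq_fintype_card]
  rw [h1, ← pow_mul, ← pow_mul]
  congr 1
  have hk1 := dvd_card_sub_one_of_residueField k p hpk P hP hpP ι
  have hk2 := dvd_card_sub_one_of_residueField k' p hpk' P' hP' hpP' ι'
  have hqq : Fintype.card F - 1 ∣ Fintype.card F' - 1 := by
    rw [Module.card_eq_pow_finrank (K := F) (V := F')]
    exact Nat.sub_one_dvd_pow_sub_one _ _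
  obtain ⟨A, hA⟩ := hqq
  obtain ⟨B, hB⟩ := hk1
  obtain ⟨C, hC⟩ := hk2
  have hq : 0 < Fintype.card F - 1 := by
    have := Fintype.one_lt_card (α := F)
    omega
  have e1 : (Fintype.card F' - 1) / k' = C := by rw [hC, Nat.mul_div_cancel_left _ (NeZero.pos k')]
  have e2 : (Fintype.card F' - 1) / (Fintype.card F - 1) = A := by
    rw [hA, Nat.mul_div_cancel_left _ hq]
  have e3 : (Fintype.card F - 1) / k = B := by rw [hB, Nat.mul_div_cancel_left _ (NeZero.pos k)]
  rw [e1, e2, e3]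
  refine Nat.eq_of_mul_eq_mul_left (NeZero.pos k) ?_
  calc k * (C * r) = k' * C := by rw [hk']; ring
    _ = k * (A * B) := by rw [← hC, hA, hB]; ring

include hr hk' hpk hpk' hP hpP hP' hpP' hPP' in
-- Davenport–Hasse, whose sign (-1)^(r-1) is 1 for odd r. The compatibility of γ and ω is what puts
-- the same z on both sides.
theorem gammaSum_eq_gammaSum_pow [Algebra (ZMod p) F] [Algebra (ZMod p) F'] (hr_odd : Odd r)
    (hcard : Fintype.card F' = Fintype.card F ^ r)
    {γ : Fˣ} (hγ : Subgroup.zpowers γ = ⊤) {ω : F'ˣ} (hω : Subgroup.zpowers ω = ⊤)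
    (hγω : teichmullerChar k' P' ι' (ω : F') ^ r = teichmullerChar k P ι (γ : F))
    {z : ℂ} (hz : z ^ k = 1) : gammaSum p ω z = gammaSum p γ z ^ r := by
  obtain ⟨φ, hφ⟩ := exists_quotient_ringHom k k' r hr hk' P P' hPP'
  -- The embedding of F in F' must be the one induced by P ⊆ P', so that the norm matches the
  -- Teichmüller characters.
  let _ : Algebra F F' := ((ι'.toRingHom.comp φ).comp ι.symm.toRingHom).toAlgebra
  have halg : ∀ x : 𝓞 (cycField k) ⧸ P, algebraMap F F' (ι x) = ι' (φ x) := fun x =>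
    congrArg (fun x => ι' (φ x)) (ι.symm_apply_apply x)
  have hrank : Module.finrank F F' = r := by
    have h1 := Module.card_eq_pow_finrank (K := F) (V := F')
    rw [hcard] at h1
    exact (Nat.pow_right_injective Fintype.one_lt_card h1).symm
  have hnorm0 : Algebra.norm F (ω : F') ≠ 0 := Algebra.norm_ne_zero_iff.mpr ω.ne_zero
  obtain ⟨y, -, hy⟩ := exists_pow_eq_of_ne_zero hγ hnorm0
  have hg := isPrimitiveRoot_teichmullerChar k p hpk P hP hpP ι hγ
  -- Norm(ω) = γ^y gives g^y = χ_P(Norm ω) = w^r = g; hence z^y = z for every power z of g.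
  have hgy : teichmullerChar k P ι (γ : F) ^ y = teichmullerChar k P ι (γ : F) := by
    rw [← teichmullerChar_pow k p hpk P hP hpP ι γ.ne_zero, hy, ← hγω]
    exact teichmullerChar_norm k k' r p hr hk' hpk hpk' P hP hpP P' hP' hpP' ι ι' hφ halg ω.ne_zero
  have hzy : z ^ y = z := by
    obtain ⟨i, -, rfl⟩ := hg.eq_pow_of_pow_eq_one hz
    rw [pow_right_comm, hgy]
  have hzq : z ^ (Fintype.card F - 1) = 1 := by
    obtain ⟨l, hl⟩ := dvd_card_sub_one_of_residueField k p hpk P hP hpP ι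
    rw [hl, pow_mul, hz, one_pow]
  have h := gammaSum_lift p hγ hω hy.symm hzq
  rwa [hzy, hrank, (Nat.Odd.sub_odd hr_odd odd_one).neg_one_pow, one_mul] at h

end ResidueFieldLift

end

/-! ### Comparison of the value sets and the main theorem. -/

theorem exists_lt_dvd_add_mul {r N : ℕ} (hr : r ≠ 0) (hrN : r.Coprime N) (a : ℕ) :
    ∃ u < r, r ∣ a + u * N := by
  obtain ⟨x, hx⟩ : ∃ x, a + x * N ≡ 0 [MOD r] := by
    obtain ⟨x, -, hx⟩ := exists_coprime_mul_modEq (x := N) (y := 1) hr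
      (by rw [Nat.gcd_one_left]; exact hrN.symm)
    refine ⟨x * ((r - 1) * a), ?_⟩
    have h1 : a + x * ((r - 1) * a) * N = a + N * x * ((r - 1) * a) := by ring
    rw [h1]
    refine ((hx.mul_right _).add_left a).trans ?_
    rw [one_mul, Nat.modEq_zero_iff_dvd]
    refine ⟨a, ?_⟩
    obtain ⟨r, rfl⟩ := Nat.exists_eq_succ_of_ne_zero hr
    simp only [Nat.succ_eq_add_one, Nat.add_sub_cancel]
    ring
  refine ⟨x % r, Nat.mod_lt _ (Nat.pos_of_ne_zero hr), (Nat.modEq_zero_iff_dvd).mp ?_⟩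
  exact (((Nat.mod_modEq x r).mul_right N).add_left a).trans hx

theorem image_psiValues {p : ℕ} [Fact p.Prime] {F : Type*} [Field F] [Fintype F]
    [Algebra (ZMod p) F] {F' : Type*} [Field F'] [Fintype F'] [Algebra (ZMod p) F']
    {γ : Fˣ} {ω : F'ˣ} {D : Set F} {D' : Set F'} {r N : ℕ} (hr : r ≠ 0) (hrN : r.Coprime N)
    {φ : ℂ → ℂ} (h : ∀ a b u : ℕ, u < r → a + u * N = r * b →
      psiSum p ((ω : F') ^ a) D' = φ (psiSum p ((γ : F) ^ b) D)) :
    psiValues p ω D' = φ '' psiValues p γ D := by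
  rw [psiValues_eq_range, psiValues_eq_range, ← Set.range_comp]
  apply Set.Subset.antisymm
  · rintro _ ⟨a, rfl⟩
    obtain ⟨u, hu, b, hb⟩ := exists_lt_dvd_add_mul hr hrN a
    exact ⟨b, (h a b u hu hb).symm⟩
  · rintro _ ⟨b, rfl⟩
    exact ⟨r * b, h (r * b) b 0 (Nat.pos_of_ne_zero hr) (by ring)⟩

theorem theorem3p2
    -- the integers `h = 2 ^ t p_1 ⋯ p_ℓ`, `k = 2 ^ t p_1 ^ e_1 ⋯ p_ℓ ^ e_ℓ`, `k' = k p_1`,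
    -- with `p_i = r (i - 1)` and `e_i = m (i - 1)`
    (ℓ : ℕ) [NeZero ℓ] (t : ℕ) (r : Fin ℓ → ℕ) (m : Fin ℓ → ℕ)
    (hr_prime : ∀ i, (r i).Prime) (hr_odd : ∀ i, Odd (r i)) (hr_inj : Function.Injective r)
    (hm : ∀ i, 1 ≤ m i)
    (h k k' : ℕ) (hh : h = 2 ^ t * ∏ i, r i) (hk : k = 2 ^ t * ∏ i, r i ^ m i)
    (hk' : k' = k * r 0)
    -- the prime `p`, the index hypothesis on `⟨p⟩`, and the index `e` of `⟨p⟩` modulo `h`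
    (p : ℕ) [Fact p.Prime] (hph : p.Coprime h)
    (hindex : ∀ s ≤ t, ∀ S : Finset (Fin ℓ), ∀ x : Fin ℓ → ℕ, (∀ i ∈ S, 1 ≤ x i) →
      powIndex p (2 ^ s * ∏ i ∈ S, r i ^ x i) = powIndex p (2 ^ s * ∏ i ∈ S, r i))
    (e f f' : ℕ) (he : e = powIndex p h)
    (hf : f = Nat.totient k / e) (hf' : f' = Nat.totient k' / e)
    -- the finite fields `𝔽_q` and `𝔽_{q'}`, `q = p ^ f`, `q' = p ^ f'`
    {F : Type*} [Field F] [Fintype F] [Algebra (ZMod p) F] (hF : Fintype.card F = p ^ f)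
    {F' : Type*} [Field F'] [Fintype F'] [Algebra (ZMod p) F'] (hF' : Fintype.card F' = p ^ f')
    -- prime ideals `P` of `ℤ[ζ_k]` and `P'` of `ℤ[ζ_{k'}]` over `p` with `P' ∩ ℤ[ζ_k] = P`, and
    -- identifications of their residue fields with `𝔽_q` and `𝔽_{q'}`
    (P : Ideal (𝓞 (cycField k))) (hP : P.IsPrime)
    (hpP : (p : 𝓞 (cycField k)) ∈ P)
    (P' : Ideal (𝓞 (cycField k'))) (hP' : P'.IsPrime)
    (hpP' : (p : 𝓞 (cycField k')) ∈ P')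
    (hPP' : ∀ (x : 𝓞 (cycField k)) (y : 𝓞 (cycField k')),
      ((x : cycField k) : ℂ) = ((y : cycField k') : ℂ) → (x ∈ P ↔ y ∈ P'))
    (ι : (𝓞 (cycField k) ⧸ P) ≃+* F) (ι' : (𝓞 (cycField k') ⧸ P') ≃+* F')
    -- primitive roots `γ` and `ω`, chosen compatibly: `χ_{P'}(ω) ^ p_1 = χ_P(γ)`
    (γ : Fˣ) (hγ : Subgroup.zpowers γ = ⊤) (ω : F'ˣ) (hω : Subgroup.zpowers ω = ⊤)
    (hγω : teichmullerChar k' P' ι' (ω : F') ^ (r 0) = teichmullerChar k P ι (γ : F))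
    -- the partition `J_1 ⊔ J_2` of the set of divisors of `k` not divisible by `p_1 ^ e_1`
    (J₁ J₂ : Set ℕ) (hJ : J₁ ∪ J₂ = {x : ℕ | x ∣ k ∧ ¬ (r 0) ^ (m 0) ∣ x})
    (hJdisj : Disjoint J₁ J₂)
    (I : Finset ℕ) (hI : I ⊆ Finset.range k)
    (ε : ℤ) (hε : ε = 1 ∨ ε = -1)
    -- (i)
    (h_i : ∀ j ∈ J₁, ∑ i ∈ I, zetaC k ^ (i * j) = 0)
    -- (ii)
    (h_ii : ∀ j ∈ J₂,
      relGaussSum p f' f (teichmullerChar k' P' ι' ^ j) (teichmullerChar k P ι ^ j) = (ε : ℂ))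
    -- (iii)
    (h_iii : 2 ≤ ℓ ∨ 1 ≤ t → ∀ v : ℕ, 1 ≤ v → v ≤ k / (r 0) ^ (m 0) - 1 →
      gaussS p (teichmullerChar k' P' ι' ^ (-(((r 0) ^ (m 0 + 1) * v : ℕ) : ℤ))) =
        (ε : ℂ) *
          (((p : ℝ) ^ (((Nat.totient k' : ℝ) - (Nat.totient k : ℝ)) / (2 * (e : ℝ))) : ℝ) : ℂ) *
          gaussS p (teichmullerChar k P ι ^ (-(((r 0) ^ (m 0) * v : ℕ) : ℤ))))
    -- the set `D`, its lift `D'`, and the scaling factor `c = ε p ^ (φ(k) (p_1 - 1) / (2 e))`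
    (D : Set F) (hD : D = ⋃ i ∈ I, cycClass k γ i)
    (D' : Set F')
    (hD' : D' = ⋃ i ∈ I, ⋃ j ∈ Finset.range (r 0),
      cycClass (k * r 0) ω (i * r 0 + j * (k / (r 0) ^ (m 0))))
    (c : ℂ)
    (hc : c = (ε : ℂ) *
      (((p : ℝ) ^ ((Nat.totient k : ℝ) * ((r 0 : ℝ) - 1) / (2 * (e : ℝ))) : ℝ) : ℂ))
    (htwo : (psiValues p γ D).ncard = 2) :
    (psiValues p ω D').ncard = 2 ∧
      psiValues p ω D' =
        (fun s : ℂ => c * s + (I.card : ℂ) * (c - 1) / (k : ℂ)) '' psiValues p γ D := by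
  classical
  set r₀ := r 0 with hr₀
  set m₀ := m 0 with hm₀
  set N := k / r₀ ^ m₀ with hN
  have hp : p.Prime := Fact.out
  have hr : r₀.Prime := hr_prime 0
  have hr_odd₀ : Odd r₀ := hr_odd 0
  have hkN : k = r₀ ^ m₀ * (2 ^ t * ∏ i ∈ Finset.univ.erase 0, r i ^ m i) := by
    rw [hk, ← Finset.mul_prod_erase _ _ (Finset.mem_univ (0 : Fin ℓ))]
    ring
  have hN' : N = 2 ^ t * ∏ i ∈ Finset.univ.erase 0, r i ^ m i := by
    rw [hN, hkN, Nat.mul_div_cancel_left _ (pow_pos hr.pos _)]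
  rw [← hN'] at hkN
  have hrN : r₀.Coprime N := by
    rw [hN']
    refine Nat.Coprime.mul_right (Nat.Coprime.pow_right t hr_odd₀.coprime_two_right)
      (Nat.Coprime.prod_right fun i hi => Nat.Coprime.pow_right _ ?_)
    refine (Nat.coprime_primes hr (hr_prime i)).mpr fun h1 => ?_
    exact (Finset.ne_of_mem_erase hi) (hr_inj h1).symm
  have hk0 : k ≠ 0 := by
    rw [hk]
    exact mul_ne_zero (pow_ne_zero _ two_ne_zero)
      (Finset.prod_ne_zero_iff.mpr fun i _ => pow_ne_zero _ (hr_prime i).ne_zero)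
  have hk'0 : k' ≠ 0 := hk' ▸ mul_ne_zero hk0 hr.ne_zero
  have hh0 : h ≠ 0 := by
    rw [hh]
    exact mul_ne_zero (pow_ne_zero _ two_ne_zero)
      (Finset.prod_ne_zero_iff.mpr fun i _ => (hr_prime i).ne_zero)
  have : NeZero k := ⟨hk0⟩
  have : NeZero k' := ⟨hk'0⟩
  have hpr : ∀ i, p.Coprime (r i) := fun i =>
    hph.coprime_dvd_right (hh ▸ (Finset.dvd_prod_of_mem r (Finset.mem_univ i)).mul_left _)
  have hpk : p.Coprime k := by
    rw [hk]
    exact Nat.Coprime.mul_right (hph.coprime_dvd_right (hh ▸ dvd_mul_right _ _))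
      (Nat.Coprime.prod_right fun i _ => (hpr i).pow_right _)
  have hpk' : p.Coprime k' := hk' ▸ Nat.Coprime.mul_right hpk (hpr 0)
  -- The index hypothesis at d' = k makes e divide φ(k). So the natural-number quotients f and f'
  -- are exact, and φ(k') = r φ(k) yields f' = r f.
  have he1 : powIndex p k = e := by
    rw [hk, hindex t le_rfl Finset.univ m (fun i _ => hm i), he, hh]
  have he0 : e ≠ 0 := he1 ▸ powIndex_ne_zero p k hk0
  have hef : k.totient = e * f := by
    rw [hf, Nat.mul_div_cancel' (he1 ▸ powIndex_dvd_totient p k hk0)]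
  have hrk : r₀ ∣ k := by
    rw [hkN]
    exact (dvd_pow_self _ (by have := hm 0; omega)).mul_right _
  have htot : k'.totient = e * (r₀ * f) := by
    rw [hk', totient_mul_prime_of_dvd hr hrk, hef]
    ring
  have hff' : f' = r₀ * f := by
    rw [hf', htot, Nat.mul_div_cancel_left _ (Nat.pos_of_ne_zero he0)]
  have hcard : Fintype.card F' = Fintype.card F ^ r₀ := by
    rw [hF', hF, hff', ← pow_mul, mul_comm]
  obtain ⟨s, hs⟩ : ∃ s, r₀ = 2 * s + 1 := hr_odd 0
  have heR : (e : ℝ) ≠ 0 := Nat.cast_ne_zero.mpr he0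
  -- The real exponents in (ii), (iii) and c all equal f s with s = (r - 1)/2, so c is an integer.
  have hexp : ∀ x : ℝ, x = f * s → (((p : ℝ) ^ x : ℝ) : ℂ) = (p : ℂ) ^ (f * s) := by
    rintro x rfl
    rw [← Nat.cast_mul, Real.rpow_natCast]
    push_cast
    rfl
  have hsR : (r₀ : ℝ) = 2 * s + 1 := by rw [hs]; push_cast; rfl
  rw [hexp _ (by rw [hef, hsR]; push_cast; field_simp; ring)] at hc
  have hcI : c = ((ε * (p : ℤ) ^ (f * s) : ℤ) : ℂ) := by rw [hc]; push_cast; rfl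
  have hpC : (p : ℂ) ≠ 0 := Nat.cast_ne_zero.mpr hp.ne_zero
  have hε2 : (ε : ℂ) ^ 2 = 1 := by rcases hε with rfl | rfl <;> norm_num
  have hε0 : (ε : ℂ) ≠ 0 := by rintro h1; rw [h1] at hε2; norm_num at hε2
  have hc0 : c ≠ 0 := hc ▸ mul_ne_zero hε0 (pow_ne_zero _ hpC)
  have hc2 : c ^ 2 = (Fintype.card F : ℂ) ^ (r₀ - 1) := by
    rw [hc, mul_pow, hε2, hF, hs, Nat.add_sub_cancel]
    push_cast
    ring
  set g := teichmullerChar k P ι (γ : F) with hg_def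
  set w := teichmullerChar k' P' ι' (ω : F') with hw_def
  have hg : IsPrimitiveRoot g k := isPrimitiveRoot_teichmullerChar k p hpk P hP hpP ι hγ
  have hw : IsPrimitiveRoot w (k * r₀) :=
    hk' ▸ isPrimitiveRoot_teichmullerChar k' p hpk' P' hP' hpP' ι' hω
  have hkF : k ∣ Fintype.card F - 1 := dvd_card_sub_one_of_residueField k p hpk P hP hpP ι
  have hkF' : k * r₀ ∣ Fintype.card F' - 1 :=
    hk' ▸ dvd_card_sub_one_of_residueField k' p hpk' P' hP' hpP' ι'
  have hχ : ∀ n : ℕ, teichmullerChar k P ι ((γ : F) ^ n) = g ^ n :=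
    teichmullerChar_pow k p hpk P hP hpP ι γ.ne_zero
  have hχ' : ∀ n : ℕ, teichmullerChar k' P' ι' ((ω : F') ^ n) = w ^ n :=
    teichmullerChar_pow k' p hpk' P' hP' hpP' ι' ω.ne_zero
  have hG : ∀ j : ℕ, gaussS p (teichmullerChar k P ι ^ j) = gammaSum p γ (g ^ j) := fun j =>
    gaussS_eq_gammaSum p hγ fun n => by rw [Pi.pow_apply, hχ, pow_right_comm]
  have hG' : ∀ j : ℕ, gaussS p (teichmullerChar k' P' ι' ^ j) = gammaSum p ω (w ^ j) := fun j =>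
    gaussS_eq_gammaSum p hω fun n => by rw [Pi.pow_apply, hχ', pow_right_comm]
  have hGneg : ∀ j : ℕ, gaussS p (teichmullerChar k P ι ^ (-(j : ℤ))) =
      gammaSum p γ (g⁻¹ ^ j) := fun j =>
    gaussS_eq_gammaSum p hγ fun n => by
      rw [Pi.pow_apply, hχ, zpow_neg, zpow_natCast, pow_right_comm g, inv_pow, inv_pow]
  have hGneg' : ∀ j : ℕ, gaussS p (teichmullerChar k' P' ι' ^ (-(j : ℤ))) =
      gammaSum p ω (w⁻¹ ^ j) := fun j =>
    gaussS_eq_gammaSum p hω fun n => by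
      rw [Pi.pow_apply, hχ', zpow_neg, zpow_natCast, pow_right_comm w, inv_pow, inv_pow]
  have hlift : ∀ z : ℂ, z ^ k = 1 → gammaSum p ω z = gammaSum p γ z ^ r₀ := fun z hz =>
    gammaSum_eq_gammaSum_pow k k' r₀ p hr.ne_zero hk' hpk hpk' P hP hpP P' hP' hpP' hPP' ι ι'
      hr_odd₀ hcard hγ hω hγω hz
  have hA : ∀ j, ¬ r₀ ^ m₀ ∣ j → ∑ i ∈ I, g ^ (j * i) = 0 ∨
      gammaSum p ω (w⁻¹ ^ j) = c * gammaSum p γ (g⁻¹ ^ j) := by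
    intro j hj
    have hdk : j.gcd (k * r₀) ∣ k := gcd_mul_prime_dvd hr hrN hkN hj
    have hdJ : j.gcd (k * r₀) ∈ J₁ ∪ J₂ := by
      rw [hJ]
      exact ⟨hdk, fun h1 => hj (h1.trans (Nat.gcd_dvd_left _ _))⟩
    rcases hdJ with hd | hd
    · left
      refine sum_pow_mul_eq_zero_of_gcd_eq hg hk0 (Complex.isPrimitiveRoot_exp k hk0)
        ?_ (h_i _ hd)
      rw [Nat.gcd_assoc, Nat.gcd_mul_right_left]
    · right
      rw [hcI]
      refine gammaSum_eq_of_gcd_eq p hw hγω hkF' (mul_ne_zero hk0 hr.ne_zero)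
        (d := j.gcd (k * r₀)) (by rw [Nat.gcd_assoc, Nat.gcd_self]) ?_
      have h1 := h_ii _ hd
      rw [relGaussSum, hG, hG', hexp _ (by rw [hff']; push_cast; rw [hsR]; ring)] at h1
      -- A zero denominator would make the quotient 0, which is not ε.
      have h2 : (p : ℂ) ^ (f * s) * gammaSum p γ (g ^ j.gcd (k * r₀)) ≠ 0 := by
        intro h3
        rw [h3, div_zero] at h1
        exact hε0 h1.symm
      rw [div_eq_iff h2] at h1
      rw [h1]
      push_cast
      ring
  have hB : ∀ v, ¬ N ∣ v → gammaSum p ω (w⁻¹ ^ (r₀ ^ (m₀ + 1) * v)) =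
      c * gammaSum p γ (g⁻¹ ^ (r₀ ^ (m₀ + 1) * v)) := by
    intro v hv
    refine gammaSum_eq_of_not_dvd p hγ hr hrN hkN hg hγω hkF hc2 hlift (fun x hx1 hx2 => ?_) hv
    -- Otherwise N = 1 and the range 1 ≤ x ≤ N - 1 is empty.
    have hcond : 2 ≤ ℓ ∨ 1 ≤ t := by
      by_contra! hcon
      have hℓ : ℓ = 1 := by
        have := NeZero.ne ℓ
        omega
      subst hℓ
      have hN1 : N = 1 := by
        rw [hN', show t = 0 by omega]
        simp
      omega
    have h1 := h_iii hcond x hx1 hx2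
    rwa [hGneg, hGneg', hexp _ (by
      rw [htot, hef]; push_cast; rw [hsR]; field_simp; ring), ← hc] at h1
  have hmain : psiValues p ω D' =
      (fun z : ℂ => c * z + (I.card : ℂ) * (c - 1) / (k : ℂ)) '' psiValues p γ D := by
    refine image_psiValues hr.ne_zero hrN fun a b u hu hab => ?_
    rw [hD, hD']
    exact psiSum_lift p hγ hω hr hrN hkN hg hw hγω hkF hkF' hI hA hB hu hab
  refine ⟨?_, hmain⟩
  rw [hmain, Set.ncard_image_of_injective _ ?_, htwo]
  intro x y hxy
  exact mul_left_cancel₀ hc0 (add_right_cancel hxy)
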